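/- Let $t,\theta$ be indeterminates and let $v_1,v_2,\dots$ be commuting variables; put $v_0=1$ and $v_a=0$ for $a<0$, and $v_\alpha=v_{\alpha_1}v_{\alpha_2}\cdots$ for an integer sequence $\alpha=(\alpha_1,\alpha_2,\dots)$ with finitely many nonzero entries. For $1\le i<j$ let $R_{ij}$ and $L_{ij}$ be the operators on integer sequences given by $R_{ij}\alpha=(\dots,\alpha_i+1,\dots,\alpha_j-1,\dots)$ and $L_{ij}\alpha=(\dots,\alpha_i-1,\dots,\alpha_j-1,\dots)$. In $\mathbb Q(t)[\theta][v_1,v_2,\dots]$ define $$V^{\imath}_\alpha=\prod_{1\le i<j}\frac{1-\theta L_{ij}}{1-\theta tL_{ij}}\,\frac{1-R_{ij}}{1-tR_{ij}}\;v_\alpha ,$$ meaning that the product is expanded, using $\frac{1-u}{1-tu}=1+\sum_{k\ge1}(t^k-t^{k-1})u^k$, into monomials in the operators $R_{ij},L_{ij}$, each monomial acts on the index $\alpha$, and the resulting terms $v_\beta$ are added up with their coefficients (only finitely many of them are nonzero). For partitions $\nu,\lambda$ write $\nu\stackrel{b}{\to}\lambda$ if $\nu_i\le\lambda_i$ for all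 $i$ and $\sigma=\lambda-\nu$ is a horizontal $b$-strip, i.e. $\sigma$ has $b$ boxes, at most one in each column. Let $\sigma'_i$ be the number of boxes of $\sigma$ in column $i$, let $m_i(\mu)$ be the number of parts of $\mu$ equal to $i$, and put $$\varphi_{\lambda/\nu}(t)=\prod_{i\ge1:\ \sigma'_i=1,\ \sigma'_{i+1}=0}\bigl(1-t^{m_i(\lambda)}\bigr),\qquad \psi_{\lambda/\nu}(t)=\prod_{j\ge1:\ \sigma'_j=0,\ \sigma'_{j+1}=1}\bigl(1-t^{m_j(\nu)}\bigr).$$ Then for every integer $r\ge1$ and every partition $\mu$, $$V^{\imath}_\mu\cdot v_r=\sum_{a+b=r}\ \sum_{\nu\stackrel{a}{\to}\mu,\ \nu\stackrel{b}{\to}\lambda}\theta^{a}\,\varphi_{\mu/\nu}(t)\,\psi_{\lambda/\nu}(t)\,V^{\imath}_\lambda ,$$ where $a,b\ge0$ and the inner sum runs over all pairs $(\nu,\lambda)$ of partitions with $\nu\stackrel{a}{\to}\mu$ and $\nu\stackrel{b}{\to}\lambda$. -/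

import Mathlib

noncomputable section

namespace IHL

open Finset

/-! ### The coefficient rings -/

/-- The field `ℚ(t)`. -/
abbrev Kt : Type := RatFunc ℚ

/-- The indeterminate `t`, as an element of `ℚ(t)`. -/
def tt : Kt := RatFunc.X

/-- The ring `ℚ(t)[θ]`. -/
abbrev Ktθ : Type := Polynomial Kt

/-- The indeterminate `θ`. -/
def θ : Ktθ := Polynomial.X

/-- The ring `ℚ(t)[θ][v₁, v₂, …]`. -/
abbrev Lam : Type := MvPolynomial ℕ+ Ktθ

/-- `v_a` for an integer `a`: the variable `v_a` if `a ≥ 1`, with `v_0 = 1` and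
`v_a = 0` for `a < 0`. -/
def v (a : ℤ) : Lam :=
  if h : 0 < a then MvPolynomial.X ⟨a.toNat, by omega⟩ else if a = 0 then 1 else 0

theorem v_zero : v 0 = 1 := by simp [v]

theorem v_neg {a : ℤ} (h : a < 0) : v a = 0 := by
  have h1 : ¬ 0 < a := by omega
  have h2 : a ≠ 0 := by omega
  simp [v, h1, h2]

/-- `v_α = v_{α₁} v_{α₂} ⋯` for an integer sequence with finitely many nonzero entries
(entries are indexed from `0` here). -/
def vSeq (α : ℕ →₀ ℤ) : Lam := α.prod fun _ a => v a

theorem vSeq_eq_zero {α : ℕ →₀ ℤ} {i : ℕ} (h : α i < 0) : vSeq α = 0 :=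
  Finset.prod_eq_zero (Finsupp.mem_support_iff.2 h.ne) (v_neg h)

/-! ### Raising and lowering operators -/

/-- The raising operator `R_{ij}` on integer sequences. -/
def raiseOp (i j : ℕ) (α : ℕ →₀ ℤ) : ℕ →₀ ℤ :=
  α + (Finsupp.single i 1 - Finsupp.single j 1)

/-- The lowering operator `L_{ij}` on integer sequences. -/
def lowerOp (i j : ℕ) (α : ℕ →₀ ℤ) : ℕ →₀ ℤ :=
  α + (-Finsupp.single i 1 - Finsupp.single j 1)

/-- Pairs of positions `i < j`. -/
abbrev Pairs : Type := {ij : ℕ × ℕ // ij.1 < ij.2}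

/-- The effect of the monomial `∏_{i<j} R_{ij}^{p_{ij}} ∏_{i<j} L_{ij}^{s_{ij}}` on an integer
sequence (all these operators are commuting translations). -/
def monomialOp (p s : Pairs →₀ ℕ) (α : ℕ →₀ ℤ) : ℕ →₀ ℤ :=
  α + (p.sum fun ij k => k • (Finsupp.single ij.1.1 (1 : ℤ) - Finsupp.single ij.1.2 1))
    + (s.sum fun ij k => k • (-Finsupp.single ij.1.1 (1 : ℤ) - Finsupp.single ij.1.2 1))

theorem monomialOp_zero (α : ℕ →₀ ℤ) : monomialOp 0 0 α = α := by
  simp [monomialOp]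

/-- One more factor `R_{ij}` acts by the raising operator. -/
theorem monomialOp_single_add_left (ij : Pairs) (p s : Pairs →₀ ℕ) (α : ℕ →₀ ℤ) :
    monomialOp (p + Finsupp.single ij 1) s α
      = raiseOp ij.1.1 ij.1.2 (monomialOp p s α) := by
  simp only [monomialOp, raiseOp]
  rw [Finsupp.sum_add_index' (by simp) (fun _ _ _ => add_smul _ _ _),
    Finsupp.sum_single_index (by simp), one_smul]
  abel

/-- One more factor `L_{ij}` acts by the lowering operator. -/
theorem monomialOp_single_add_right (ij : Pairs) (p s : Pairs →₀ ℕ) (α : ℕ →₀ ℤ) :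
    monomialOp p (s + Finsupp.single ij 1) α
      = lowerOp ij.1.1 ij.1.2 (monomialOp p s α) := by
  simp only [monomialOp, lowerOp]
  rw [Finsupp.sum_add_index' (by simp) (fun _ _ _ => add_smul _ _ _),
    Finsupp.sum_single_index (by simp), one_smul]
  abel

/-- The coefficient of `u^k` in `F(u) = (1 - u) / (1 - t u) ∈ ℚ(t)⟦u⟧`. -/
def fCoeff (k : ℕ) : Kt :=
  PowerSeries.coeff k
    ((1 - PowerSeries.X) * (1 - PowerSeries.C tt * PowerSeries.X)⁻¹ : PowerSeries Kt)

theorem fCoeff_zero : fCoeff 0 = 1 := by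
  simp [fCoeff]

/-- The coefficient of `∏ R_{ij}^{p_{ij}} ∏ L_{ij}^{s_{ij}}` in the formal expansion of
`∏_{i<j} F(θ L_{ij}) F(R_{ij})`. -/
def opCoeff (p s : Pairs →₀ ℕ) : Ktθ :=
  (p.prod fun _ k => Polynomial.C (fCoeff k)) *
    (s.prod fun _ k => θ ^ k * Polynomial.C (fCoeff k))

/-- The polynomial `V^ı_α = ∏_{i<j} F(θ L_{ij}) F(R_{ij}) v_α`: the product is expanded into
monomials in the operators, these act on the index `α`, and the resulting terms are added up
(only finitely many of them are nonzero: see `finite_support_Vi`). -/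
def Vi (α : ℕ →₀ ℤ) : Lam :=
  ∑ᶠ ps : (Pairs →₀ ℕ) × (Pairs →₀ ℕ), opCoeff ps.1 ps.2 • vSeq (monomialOp ps.1 ps.2 α)

/-- The weight `∑ i² α_i`, which every `R_{ij}` and `L_{ij}` decreases by at least `j`. -/
def wt : (ℕ →₀ ℤ) →+ ℤ :=
  Finsupp.liftAddHom fun i => (AddMonoidHom.mulLeft ((i : ℤ) ^ 2))

theorem wt_single (i : ℕ) (a : ℤ) : wt (Finsupp.single i a) = (i : ℤ) ^ 2 * a := by
  simp [wt]

theorem wt_nonneg {α : ℕ →₀ ℤ} (h : ∀ i, 0 ≤ α i) : 0 ≤ wt α := by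
  rw [wt, Finsupp.liftAddHom_apply]
  exact Finset.sum_nonneg fun i _ => mul_nonneg (by positivity) (h i)

theorem wt_monomialOp_le (p s : Pairs →₀ ℕ) (α : ℕ →₀ ℤ) :
    wt (monomialOp p s α) + (p.sum fun ij k => (k : ℤ) * ij.1.2)
      + (s.sum fun ij k => (k : ℤ) * ij.1.2) ≤ wt α := by
  have h1 : wt (p.sum fun ij k => k • (Finsupp.single ij.1.1 (1 : ℤ) - Finsupp.single ij.1.2 1))
      + (p.sum fun ij k => (k : ℤ) * ij.1.2) ≤ 0 := by
    rw [Finsupp.sum, Finsupp.sum, map_sum, ← Finset.sum_add_distrib]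
    refine Finset.sum_nonpos fun ij _ => ?_
    rw [map_nsmul, map_sub, wt_single, wt_single, nsmul_eq_mul, ← mul_add]
    refine mul_nonpos_of_nonneg_of_nonpos (by positivity) ?_
    have : (ij.1.1 : ℤ) + 1 ≤ ij.1.2 := by exact_mod_cast ij.2
    nlinarith [Int.natCast_nonneg ij.1.1]
  have h2 : wt (s.sum fun ij k => k • (-Finsupp.single ij.1.1 (1 : ℤ) - Finsupp.single ij.1.2 1))
      + (s.sum fun ij k => (k : ℤ) * ij.1.2) ≤ 0 := by
    rw [Finsupp.sum, Finsupp.sum, map_sum, ← Finset.sum_add_distrib]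
    refine Finset.sum_nonpos fun ij _ => ?_
    rw [map_nsmul, map_sub, map_neg, wt_single, wt_single, nsmul_eq_mul, ← mul_add]
    refine mul_nonpos_of_nonneg_of_nonpos (by positivity) ?_
    have : (ij.1.1 : ℤ) + 1 ≤ ij.1.2 := by exact_mod_cast ij.2
    nlinarith [Int.natCast_nonneg ij.1.1]
  simp only [monomialOp, map_add]
  linarith

theorem finite_sum_le (M : ℤ) :
    {p : Pairs →₀ ℕ | (p.sum fun ij k => (k : ℤ) * ij.1.2) ≤ M}.Finite := by
  classical
  have hT : {ij : Pairs | ij.1.2 ≤ M.toNat}.Finite := by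
    refine Set.Finite.of_finite_image (f := Subtype.val) ?_ Subtype.val_injective.injOn
    refine (Finset.finite_toSet (Finset.range (M.toNat + 1) ×ˢ Finset.range (M.toNat + 1))).subset ?_
    rintro _ ⟨ij, h, rfl⟩
    have := ij.2
    simp only [Set.mem_ofPred_eq] at h
    simp only [Finset.coe_product, Set.mem_prod, Finset.mem_coe, Finset.mem_range]
    omega
  refine (Set.finite_Iic (Finsupp.indicator hT.toFinset fun _ _ => M.toNat)).subset ?_
  intro p hp ij
  simp only [Set.mem_ofPred_eq] at hp
  rcases Nat.eq_zero_or_pos (p ij) with h0 | h0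
  · simp [h0]
  have hle : (p ij : ℤ) * ij.1.2 ≤ M :=
    le_trans (Finset.single_le_sum (f := fun ij : Pairs => (p ij : ℤ) * ij.1.2)
      (fun _ _ => by positivity) (Finsupp.mem_support_iff.2 h0.ne')) hp
  have hj : (1 : ℤ) ≤ ij.1.2 := by have := ij.2; omega
  have hp1 : (1 : ℤ) ≤ p ij := by exact_mod_cast h0
  have hjM : (ij.1.2 : ℤ) ≤ M := by nlinarith
  have hpM : (p ij : ℤ) ≤ M := by nlinarith
  have hmem : ij ∈ hT.toFinset := by
    simp only [Set.Finite.mem_toFinset, Set.mem_ofPred_eq]; omega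
  rw [Finsupp.indicator_of_mem hmem]
  omega

/-- Only finitely many terms in the definition of `V^ı_α` are nonzero. -/
theorem finite_support_Vi (α : ℕ →₀ ℤ) :
    (Function.support fun ps : (Pairs →₀ ℕ) × (Pairs →₀ ℕ) =>
      opCoeff ps.1 ps.2 • vSeq (monomialOp ps.1 ps.2 α)).Finite := by
  refine ((finite_sum_le (wt α)).prod (finite_sum_le (wt α))).subset ?_
  rintro ⟨p, s⟩ h
  have hpos : ∀ i, 0 ≤ monomialOp p s α i := by
    intro i
    by_contra hneg
    exact h (by simp [vSeq_eq_zero (not_le.1 hneg)])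
  have h0 := wt_nonneg hpos
  have h1 := wt_monomialOp_le p s α
  have hp : 0 ≤ p.sum fun ij k => (k : ℤ) * ij.1.2 :=
    Finset.sum_nonneg fun _ _ => by positivity
  have hs : 0 ≤ s.sum fun ij k => (k : ℤ) * ij.1.2 :=
    Finset.sum_nonneg fun _ _ => by positivity
  constructor
  · simp only [Set.mem_ofPred_eq]; linarith
  · simp only [Set.mem_ofPred_eq]; linarith

/-! ### Partitions (as Young diagrams) and horizontal strips -/

/-- A partition `μ = (μ₁ ≥ μ₂ ≥ ⋯)` as an integer sequence. -/
def partSeq (μ : YoungDiagram) : ℕ →₀ ℤ :=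
  Finsupp.onFinset (Finset.range (μ.colLen 0)) (fun i => (μ.rowLen i : ℤ)) (by
    intro i hi
    rw [Finset.mem_range, ← YoungDiagram.mem_iff_lt_colLen, YoungDiagram.mem_iff_lt_rowLen]
    have : μ.rowLen i ≠ 0 := by exact_mod_cast hi
    omega)

/-- `m_i(μ)`: the number of parts of `μ` equal to `i` (for `i ≥ 1`). -/
def mult (i : ℕ) (μ : YoungDiagram) : ℕ := μ.rowLens.count i

/-- For `σ = lam - ν`: the number `σ'_i` of boxes of `σ` in the `i`-th column
(columns are numbered from `1`). -/
def skewCol (lam ν : YoungDiagram) (i : ℕ) : ℕ :=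
  #{c ∈ lam.cells \ ν.cells | c.2 + 1 = i}

/-- `ν →ᵇ lam`: `ν ≤ lam` and `lam - ν` is a horizontal `b`-strip. -/
def IsHorizontalStrip (b : ℕ) (ν lam : YoungDiagram) : Prop :=
  ν ≤ lam ∧ (∀ i, skewCol lam ν i ≤ 1) ∧ #(lam.cells \ ν.cells) = b

/-- `φ_{lam/ν}(x)`, the product of `1 - x^{m_i(lam)}` over all `i ≥ 1` with
`σ'_i = 1`, `σ'_{i+1} = 0`; all such `i` are at most `lam₁`. -/
def phi {A : Type*} [CommRing A] (lam ν : YoungDiagram) (x : A) : A :=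
  ∏ i ∈ Finset.Icc 1 (lam.rowLen 0) with skewCol lam ν i = 1 ∧ skewCol lam ν (i + 1) = 0,
    (1 - x ^ mult i lam)

/-- `ψ_{lam/ν}(x)`, the product of `1 - x^{m_j(ν)}` over all `j ≥ 1` with
`σ'_j = 0`, `σ'_{j+1} = 1`; all such `j` are at most `lam₁`. -/
def psi {A : Type*} [CommRing A] (lam ν : YoungDiagram) (x : A) : A :=
  ∏ j ∈ Finset.Icc 1 (lam.rowLen 0) with skewCol lam ν j = 0 ∧ skewCol lam ν (j + 1) = 1,
    (1 - x ^ mult j ν)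

theorem finite_card_le (n : ℕ) : {lam : YoungDiagram | lam.card ≤ n}.Finite := by
  refine Set.Finite.of_finite_image (f := YoungDiagram.cells) ?_
    (fun a _ b _ h => YoungDiagram.ext h)
  refine (Finset.finite_toSet
    (Finset.powerset (Finset.range n ×ˢ Finset.range n))).subset ?_
  rintro _ ⟨lam, h, rfl⟩
  simp only [Set.mem_ofPred_eq] at h
  simp only [Finset.mem_coe, Finset.mem_powerset]
  rintro ⟨i, j⟩ hij
  have hrow : lam.rowLen i ≤ lam.card := by
    rw [YoungDiagram.rowLen_eq_card]; exact Finset.card_le_card (Finset.filter_subset _ _)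
  have hcol : lam.colLen j ≤ lam.card := by
    rw [YoungDiagram.colLen_eq_card]; exact Finset.card_le_card (Finset.filter_subset _ _)
  have h1 := YoungDiagram.mem_iff_lt_rowLen.1 ((YoungDiagram.mem_cells _).1 hij)
  have h2 := YoungDiagram.mem_iff_lt_colLen.1 ((YoungDiagram.mem_cells _).1 hij)
  simp only [Finset.mem_product, Finset.mem_range]
  omega

theorem finite_downStrips (a : ℕ) (μ : YoungDiagram) :
    {ν : YoungDiagram | IsHorizontalStrip a ν μ}.Finite :=
  (finite_card_le μ.card).subset fun _ h => Finset.card_le_card h.1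

theorem finite_upStrips (b : ℕ) (ν : YoungDiagram) :
    {lam : YoungDiagram | IsHorizontalStrip b ν lam}.Finite := by
  refine (finite_card_le (b + ν.card)).subset fun lam h => ?_
  have h1 := Finset.card_sdiff_add_card_eq_card (YoungDiagram.cells_subset_iff.2 h.1)
  have h2 := h.2.2
  simp only [Set.mem_ofPred_eq]
  show #lam.cells ≤ b + #ν.cells
  omega

/-- All partitions `ν` with `ν →ᵃ μ`. -/
def downStrips (a : ℕ) (μ : YoungDiagram) : Finset YoungDiagram :=
  (finite_downStrips a μ).toFinset

/-- All partitions `lam` with `ν →ᵇ lam`. -/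
def upStrips (b : ℕ) (ν : YoungDiagram) : Finset YoungDiagram :=
  (finite_upStrips b ν).toFinset

end IHL

end

noncomputable section

namespace IHL

open Finset

/-! ### Families of raising and lowering operators -/

/-! Put F(u) = (1 - u)/(1 - tu) and let n be a position past the parts of μ. Then V_μ·v_r is the
operator product acting on μ with the extra entry r in position n, except that all factors of R_{in}
and L_{in} are left out (`cutV_add_single`). Putting a factor back costs its inverse 1/F(xu) = 1 +
(1 - t)∑_{k≥1} x^k u^k (`cutV_insert_eq_sum`). A power of L_{in} takes boxes out of row i and uses
up as many units of the entry n, each with a factor θ; a power of R_{in} transfers units from entry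
n to row i. So V_μ·v_r becomes a sum over all ways of removing a boxes from the rows and then adding
b boxes, a + b = r, with weight θ^a and a factor 1 - t for each old row touched in either phase. The
resulting shapes need not be partitions, let alone strips.

The second ingredient is straightening (`cutV_straighten`). With R_{i,i+1} also left out, the
expression is symmetric in the entries i and i + 1. Hence V_β - t·V_{Rβ}, with R = R_{i,i+1}, is
antisymmetric along the string β, Rβ, R²β, …, and summing over the string gives a linear relation
whenever β_i < β_{i+1}.

The relation fits the sum exactly. Terms in which a row receives more boxes than its gap allows
collapse to t times the term in which the gap is just filled (`straighten_two_rows`). The only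
effect is to change the coefficient 1 - t of the next row into 1 - e, where e depends on the current
row alone. Sweeping through the rows, downwards for removal and upwards for addition, one abstract
argument (`straighten`) leaves only horizontal strips, with coefficient ∏(1 - e_i) over the rows
that carry boxes. Solving the recursion for e_i shows that e_i is 0 or a power of t
(`lowerParam_eq`, `raiseParam_eq`), and the products are φ and ψ (`phi_eq_prod`, `psi_eq_prod`). -/

/-- Indices of the elementary operators: `inl (i, j)` for `R_{ij}`, `inr (i, j)` for `L_{ij}`. -/
abbrev Ops : Type := Pairs ⊕ Pairs

/-- The translation vector of an elementary operator. -/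
def stepVec : Ops → (ℕ →₀ ℤ)
  | Sum.inl e => Finsupp.single e.1.1 1 - Finsupp.single e.1.2 1
  | Sum.inr e => -Finsupp.single e.1.1 1 - Finsupp.single e.1.2 1

/-- The larger of the two positions on which an elementary operator acts. -/
def hi : Ops → ℕ := Sum.elim (fun e => e.1.2) fun e => e.1.2

/-- The translation vector of a monomial in the elementary operators. -/
def disp : (Ops →₀ ℕ) →+ (ℕ →₀ ℤ) :=
  Finsupp.liftAddHom fun e => multiplesHom _ (stepVec e)

theorem disp_eq_sum (q : Ops →₀ ℕ) : disp q = q.sum fun e k => k • stepVec e := by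
  simp only [disp, Finsupp.liftAddHom_apply]
  rfl

theorem disp_single (e : Ops) (k : ℕ) : disp (Finsupp.single e k) = k • stepVec e := by
  simp [disp]

theorem disp_apply (q : Ops →₀ ℕ) (J : ℕ) :
    disp q J = ∑ e ∈ q.support, (q e : ℤ) * stepVec e J := by
  simp [disp_eq_sum, Finsupp.sum, Finsupp.finsetSum_apply]

theorem monomialOp_eq_add_disp (q : Ops →₀ ℕ) (α : ℕ →₀ ℤ) :
    monomialOp (Finsupp.sumFinsuppEquivProdFinsupp q).1 (Finsupp.sumFinsuppEquivProdFinsupp q).2 α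
      = α + disp q := by
  induction q using Finsupp.induction_linear generalizing α with
  | zero => simp [monomialOp, Finsupp.sumFinsuppEquivProdFinsupp]
  | add f g hf hg =>
    rw [map_add disp, ← add_assoc, ← hf, ← hg]
    have h1 : Finsupp.sumFinsuppEquivProdFinsupp (f + g)
        = Finsupp.sumFinsuppEquivProdFinsupp f + Finsupp.sumFinsuppEquivProdFinsupp g :=
      map_add Finsupp.sumFinsuppAddEquivProdFinsupp f g
    rw [h1]
    simp only [monomialOp, Prod.fst_add, Prod.snd_add]
    rw [Finsupp.sum_add_index' (by simp) (fun _ _ _ => add_smul _ _ _),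
      Finsupp.sum_add_index' (by simp) (fun _ _ _ => add_smul _ _ _)]
    abel
  | single e k =>
    rw [disp_single]
    rcases e with e | e
    · have h1 : (Finsupp.sumFinsuppEquivProdFinsupp (Finsupp.single (Sum.inl e : Ops) k))
          = (Finsupp.single e k, 0) := by
        ext x <;> simp [Finsupp.single_apply]
      rw [h1]
      simp [monomialOp, stepVec]
    · have h1 : (Finsupp.sumFinsuppEquivProdFinsupp (Finsupp.single (Sum.inr e : Ops) k))
          = (0, Finsupp.single e k) := by
        ext x <;> simp [Finsupp.single_apply]
      rw [h1]
      simp [monomialOp, stepVec]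

/-- The weight bound does not involve the coefficients, so every family of coefficients, in
particular one with factors left out, gives a finite sum. -/
theorem finite_vSeq_ne_zero (α : ℕ →₀ ℤ) :
    {q : Ops →₀ ℕ | vSeq (α + disp q) ≠ 0}.Finite := by
  refine Set.Finite.of_finite_image (f := Finsupp.sumFinsuppEquivProdFinsupp) ?_
    Finsupp.sumFinsuppEquivProdFinsupp.injective.injOn
  refine ((finite_sum_le (wt α)).prod (finite_sum_le (wt α))).subset ?_
  rintro _ ⟨q, h, rfl⟩
  rw [Set.mem_ofPred_eq, ← monomialOp_eq_add_disp] at h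
  set p := (Finsupp.sumFinsuppEquivProdFinsupp q).1
  set s := (Finsupp.sumFinsuppEquivProdFinsupp q).2
  have hpos : ∀ i, 0 ≤ monomialOp p s α i := by
    intro i
    by_contra hneg
    exact h (vSeq_eq_zero (not_le.1 hneg))
  have h0 := wt_nonneg hpos
  have h1 := wt_monomialOp_le p s α
  have hp : 0 ≤ p.sum fun ij k => (k : ℤ) * ij.1.2 :=
    Finset.sum_nonneg fun _ _ => by positivity
  have hs : 0 ≤ s.sum fun ij k => (k : ℤ) * ij.1.2 :=
    Finset.sum_nonneg fun _ _ => by positivity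
  constructor
  · simp only [Set.mem_ofPred_eq]; linarith
  · simp only [Set.mem_ofPred_eq]; linarith

/-- The variable attached to an elementary operator: `1` for `R_{ij}`, `θ` for `L_{ij}`. -/
def opVar : Ops → Ktθ := Sum.elim (fun _ => 1) fun _ => θ

/-- The indeterminate `t` in `ℚ(t)[θ]`. -/
def tθ : Ktθ := Polynomial.C tt

open scoped Classical in
/-- The coefficients of `F(x_e u)`, for the operators `e` outside `Z`, and of `1` on `Z`. -/
def cutCoeff (Z : Set Ops) (e : Ops) (k : ℕ) : Ktθ :=
  if e ∈ Z then (if k = 0 then 1 else 0) else opVar e ^ k * Polynomial.C (fCoeff k)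

theorem cutCoeff_zero (Z : Set Ops) (e : Ops) : cutCoeff Z e 0 = 1 := by
  simp [cutCoeff, fCoeff_zero]

/-- The variant of `V^ı_α` in which the factors of the operators in `Z` are left out. -/
def cutV (Z : Set Ops) (α : ℕ →₀ ℤ) : Lam :=
  ∑ᶠ q : Ops →₀ ℕ, q.prod (cutCoeff Z) • vSeq (α + disp q)

theorem Vi_eq_cutV (α : ℕ →₀ ℤ) : Vi α = cutV ∅ α := by
  classical
  rw [Vi, cutV, ← finsum_comp_equiv Finsupp.sumFinsuppEquivProdFinsupp]
  refine finsum_congr fun q => ?_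
  rw [monomialOp_eq_add_disp, opCoeff]
  congr 1
  obtain ⟨⟨p, s⟩, rfl⟩ := Finsupp.sumFinsuppEquivProdFinsupp.symm.surjective q
  rw [Equiv.apply_symm_apply]
  have : (Finsupp.sumFinsuppEquivProdFinsupp.symm (p, s) : Ops →₀ ℕ)
      = p.mapDomain Sum.inl + s.mapDomain Sum.inr := by
    ext x
    rcases x with x | x
    · simp [Finsupp.mapDomain_apply Sum.inl_injective, Finsupp.mapDomain_of_notMem_range]
    · simp [Finsupp.mapDomain_apply Sum.inr_injective, Finsupp.mapDomain_of_notMem_range]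
  rw [this, Finsupp.prod_add_index_of_disjoint, Finsupp.prod_mapDomain_index_inj Sum.inl_injective,
    Finsupp.prod_mapDomain_index_inj Sum.inr_injective]
  · simp only [cutCoeff, opVar]
    simp
  · rw [Finset.disjoint_left]
    intro x hx hx'
    have h1 := Finsupp.mapDomain_support hx
    have h2 := Finsupp.mapDomain_support hx'
    simp only [Finset.mem_image] at h1 h2
    obtain ⟨a, -, rfl⟩ := h1
    obtain ⟨b, -, h⟩ := h2
    exact Sum.inr_ne_inl h

/-! ### Exchange relations for a single factor -/

theorem finite_support_cutV (c : Ops → ℕ → Ktθ) (α : ℕ →₀ ℤ) :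
    (Function.support fun q : Ops →₀ ℕ => q.prod c • vSeq (α + disp q)).Finite :=
  (finite_vSeq_ne_zero α).subset fun q h h0 => h (by simp [h0])

/-- Multiplying the series of the operator u_e by 1 - x·u_e: the factor u_e can be absorbed either
in the coefficients or in the index α. -/
theorem finsum_add_stepVec (c c' : Ops → ℕ → Ktθ) (x : Ktθ) (e : Ops) (hc : ∀ e, c e 0 = 1)
    (hc' : ∀ e, c' e 0 = 1) (hne : ∀ f, f ≠ e → c' f = c f)
    (he : ∀ k, c' e (k + 1) = c e (k + 1) - x * c e k) (α : ℕ →₀ ℤ) :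
    ∑ᶠ q : Ops →₀ ℕ, q.prod c' • vSeq (α + disp q)
      = (∑ᶠ q : Ops →₀ ℕ, q.prod c • vSeq (α + disp q))
        - x • ∑ᶠ q : Ops →₀ ℕ, q.prod c • vSeq (α + stepVec e + disp q) := by
  classical
  have hinj : Function.Injective fun q : Ops →₀ ℕ => q + Finsupp.single e 1 :=
    fun a b h => add_right_cancel h
  -- The truncated subtraction is harmless: `g` is only evaluated on monomials divisible by the
  -- operator `e`.
  let g : (Ops →₀ ℕ) → Lam := fun q =>
    (x * ((q - Finsupp.single e 1).prod c)) • vSeq (α + disp q)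
  have h1 : x • ∑ᶠ q : Ops →₀ ℕ, q.prod c • vSeq (α + stepVec e + disp q)
      = ∑ᶠ q, (Set.range fun q : Ops →₀ ℕ => q + Finsupp.single e 1).indicator g q := by
    rw [← finsum_mem_def, finsum_mem_range hinj, smul_finsum']
    · refine finsum_congr fun q => ?_
      simp only [g, add_tsub_cancel_right, mul_smul, map_add, disp_single, one_smul]
      rw [add_assoc α, add_comm (stepVec e)]
    · exact finite_support_cutV c _
  rw [h1, ← finsum_sub_distrib (finite_support_cutV c α)]
  · refine finsum_congr fun q => ?_
    by_cases hq : q ∈ Set.range fun q : Ops →₀ ℕ => q + Finsupp.single e 1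
    · rw [Set.indicator_of_mem hq]
      obtain ⟨p, rfl⟩ := hq
      simp only [g, add_tsub_cancel_right]
      rw [← sub_smul]
      congr 1
      have hr : (p + Finsupp.single e 1).erase e = p.erase e := by
        ext f
        rcases eq_or_ne f e with rfl | hf
        · simp
        · simp [hf]
      rw [← Finsupp.mul_prod_erase' (p + Finsupp.single e 1) e c' hc',
        ← Finsupp.mul_prod_erase' (p + Finsupp.single e 1) e c hc,
        ← Finsupp.mul_prod_erase' p e c hc, hr]
      have h2 : (p.erase e).prod c' = (p.erase e).prod c := by
        refine Finsupp.prod_congr fun f hf => ?_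
        rw [hne f (by rintro rfl; simp at hf)]
      rw [h2]
      simp only [Finsupp.add_apply, Finsupp.single_eq_same]
      rw [he]
      ring
    · rw [Set.indicator_of_notMem hq, sub_zero]
      have h0 : q e = 0 := by
        by_contra h0
        refine hq ⟨q - Finsupp.single e 1, ?_⟩
        refine tsub_add_cancel_of_le ?_
        rw [Finsupp.single_le_iff]
        omega
      congr 1
      refine Finsupp.prod_congr fun f hf => ?_
      rw [hne f (by rintro rfl; simp [h0] at hf)]
  · refine (finite_vSeq_ne_zero α).subset fun q h h0 => h ?_
    rw [Set.indicator_apply]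
    split_ifs <;> simp [g, h0]

/-- This is (1 - tu)F(u) = 1 - u, read off coefficientwise. -/
theorem fCoeff_one : fCoeff 1 - tt * fCoeff 0 = -1 ∧
    ∀ k, fCoeff (k + 2) - tt * fCoeff (k + 1) = 0 := by
  set f : PowerSeries Kt := (1 - PowerSeries.X) * (1 - PowerSeries.C tt * PowerSeries.X)⁻¹ with hf
  have h : f * (1 - PowerSeries.C tt * PowerSeries.X) = 1 - PowerSeries.X := by
    rw [hf, mul_assoc, PowerSeries.inv_mul_cancel, mul_one]
    simp
  have h1 : ∀ k, PowerSeries.coeff (k + 1) (1 - PowerSeries.X : PowerSeries Kt)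
      = fCoeff (k + 1) - tt * fCoeff k := by
    intro k
    rw [← h, mul_sub, mul_one, mul_comm (PowerSeries.C tt), ← mul_assoc, map_sub,
      PowerSeries.coeff_mul_C, PowerSeries.coeff_succ_mul_X, mul_comm tt]
    rfl
  constructor
  · rw [← h1]
    simp
  · intro k
    rw [← h1]
    simp [PowerSeries.coeff_X, PowerSeries.coeff_one]

/-- Restoring the factor `F(x_e u)` of one operator. -/
theorem cutV_insert (Z : Set Ops) (e : Ops) (he : e ∉ Z) (α : ℕ →₀ ℤ) :
    cutV (insert e Z) α - opVar e • cutV (insert e Z) (α + stepVec e)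
      = cutV Z α - (opVar e * tθ) • cutV Z (α + stepVec e) := by
  classical
  -- Both sides equal the sum in which `e` carries the series 1 - xu, with x = `opVar e`: it is (1 -
  -- xu)·1 on the left and (1 - txu)·F(xu) on the right.
  let c : Ops → ℕ → Ktθ := fun f k =>
    if f = e then (if k = 0 then 1 else if k = 1 then -opVar e else 0) else cutCoeff Z f k
  have hc : ∀ f, c f 0 = 1 := by
    intro f
    by_cases h : f = e <;> simp [c, h, cutCoeff_zero]
  have h1 := finsum_add_stepVec (cutCoeff (insert e Z)) c (opVar e) e (cutCoeff_zero _) hc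
    (by
      intro f hf
      ext1 k
      simp [c, hf, cutCoeff])
    (by
      intro k
      rcases k with _ | k <;> simp [c, cutCoeff]) α
  have h2 := finsum_add_stepVec (cutCoeff Z) c (opVar e * tθ) e (cutCoeff_zero _) hc
    (by
      intro f hf
      ext1 k
      simp [c, hf])
    (by
      intro k
      have hk := congrArg (Polynomial.C : Kt → Ktθ) fCoeff_one.1
      have hk' := congrArg (Polynomial.C : Kt → Ktθ) (fCoeff_one.2 (k - 1))
      rcases k with _ | k
      · simp only [map_sub, map_mul, map_neg, map_one] at hk
        simp only [c, cutCoeff, he, tθ, if_true, if_false]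
        simp only [zero_add, one_ne_zero, if_false, pow_one, pow_zero, one_mul]
        linear_combination (-opVar e) * hk
      · simp only [map_sub, map_mul, map_zero, Nat.add_sub_cancel] at hk'
        simp only [c, cutCoeff, he, tθ, if_true, if_false]
        simp only [Nat.succ_ne_zero, if_false, Nat.add_eq_right]
        linear_combination (-opVar e ^ (k + 2)) * hk') α
  unfold cutV
  exact h1.symm.trans h2

/-! ### Exchanging two adjacent positions -/

theorem swap_lt_swap {i a b : ℕ} (hab : a < b) (h : ¬ (a = i ∧ b = i + 1)) :
    Equiv.swap i (i + 1) a < Equiv.swap i (i + 1) b := by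
  simp only [Equiv.swap_apply_def]
  split_ifs <;> omega

/-- The pair `(i, i + 1)`. -/
def adj (i : ℕ) : Pairs := ⟨(i, i + 1), Nat.lt_succ_self i⟩

/-- The exchange of `i` and `i + 1`, acting on the pairs other than `(i, i + 1)`. -/
def pairSwapFun (i : ℕ) (e : Pairs) : Pairs :=
  if h : e.1.1 = i ∧ e.1.2 = i + 1 then e
  else ⟨(Equiv.swap i (i + 1) e.1.1, Equiv.swap i (i + 1) e.1.2), swap_lt_swap e.2 h⟩

theorem pairSwapFun_involutive (i : ℕ) : Function.Involutive (pairSwapFun i) := by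
  rintro ⟨⟨a, b⟩, hab⟩
  by_cases h : a = i ∧ b = i + 1
  · simp [pairSwapFun, h]
  · have h' : ¬ (Equiv.swap i (i + 1) a = i ∧ Equiv.swap i (i + 1) b = i + 1) := by
      rintro ⟨h1, h2⟩
      rw [Equiv.swap_apply_eq_iff, Equiv.swap_apply_left] at h1
      rw [Equiv.swap_apply_eq_iff, Equiv.swap_apply_right] at h2
      simp only at hab
      omega
    simp [pairSwapFun, h, h']

/-- The exchange of `i` and `i + 1` on the indices of elementary operators. -/
def opSwap (i : ℕ) : Ops ≃ Ops :=
  Equiv.sumCongr (pairSwapFun_involutive i).toPerm (pairSwapFun_involutive i).toPerm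

/-- The exchange of the entries in positions `i` and `i + 1`. -/
def seqSwap (i : ℕ) : (ℕ →₀ ℤ) ≃+ (ℕ →₀ ℤ) := Finsupp.domCongr (Equiv.swap i (i + 1))

theorem seqSwap_apply (i : ℕ) (α : ℕ →₀ ℤ) (k : ℕ) :
    seqSwap i α k = α (Equiv.swap i (i + 1) k) := by
  simp [seqSwap, Finsupp.domCongr, Finsupp.equivMapDomain_apply]

theorem seqSwap_single (i a : ℕ) (x : ℤ) :
    seqSwap i (Finsupp.single a x) = Finsupp.single (Equiv.swap i (i + 1) a) x := by
  simp [seqSwap, Finsupp.domCongr, Finsupp.equivMapDomain_single]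

/-- R_{i,i+1} must be excluded because the exchange inverts its translation; L_{i,i+1} is invariant,
and the other operators are permuted. -/
theorem stepVec_opSwap (i : ℕ) (e : Ops) (he : e ≠ Sum.inl (adj i)) :
    stepVec (opSwap i e) = seqSwap i (stepVec e) := by
  rcases e with e | e
  · have h : ¬ (e.1.1 = i ∧ e.1.2 = i + 1) := by
      rintro ⟨h1, h2⟩
      exact he (congrArg Sum.inl (Subtype.ext (Prod.ext h1 h2)))
    simp [opSwap, stepVec, pairSwapFun, h, seqSwap_single]
  · by_cases h : e.1.1 = i ∧ e.1.2 = i + 1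
    · simp only [opSwap, stepVec, pairSwapFun, h, seqSwap_single, map_sub, map_neg,
        Equiv.sumCongr_apply, Sum.map_inr, Function.Involutive.coe_toPerm, and_self, dite_true,
        Equiv.swap_apply_left, Equiv.swap_apply_right]
      abel
    · simp [opSwap, stepVec, pairSwapFun, h, seqSwap_single]

theorem opVar_opSwap (i : ℕ) (e : Ops) : opVar (opSwap i e) = opVar e := by
  rcases e with e | e <;> simp [opSwap, opVar]

theorem vSeq_seqSwap (i : ℕ) (α : ℕ →₀ ℤ) : vSeq (seqSwap i α) = vSeq α := by
  simp [vSeq, seqSwap, Finsupp.domCongr, Finsupp.prod_equivMapDomain]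

theorem disp_equivMapDomain (i : ℕ) (q : Ops →₀ ℕ) (hq : q (Sum.inl (adj i)) = 0) :
    disp (q.equivMapDomain (opSwap i)) = seqSwap i (disp q) := by
  rw [disp_eq_sum, disp_eq_sum, map_finsuppSum, Finsupp.sum_equivMapDomain]
  refine Finsupp.sum_congr fun e he => ?_
  rw [stepVec_opSwap i e (by rintro rfl; simp [hq] at he), map_nsmul]

/-- R_{i,i+1} is the only operator that breaks the symmetry between positions i and i + 1. Monomials
containing it have coefficient zero here, and the rest are permuted with v_α unchanged. -/
theorem cutV_seqSwap (Z : Set Ops) (i : ℕ) (hi : Sum.inl (adj i) ∈ Z)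
    (hZ : ∀ e, opSwap i e ∈ Z ↔ e ∈ Z) (α : ℕ →₀ ℤ) : cutV Z (seqSwap i α) = cutV Z α := by
  rw [cutV, cutV, ← finsum_comp_equiv (Finsupp.domCongr (opSwap i)).toEquiv]
  refine finsum_congr fun q => ?_
  change (q.equivMapDomain (opSwap i)).prod (cutCoeff Z)
    • vSeq (seqSwap i α + disp (q.equivMapDomain (opSwap i))) = _
  have h1 : (q.equivMapDomain (opSwap i)).prod (cutCoeff Z) = q.prod (cutCoeff Z) := by
    rw [Finsupp.prod_equivMapDomain]
    refine Finsupp.prod_congr fun e _ => ?_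
    by_cases h : e ∈ Z
    · simp [cutCoeff, h, (hZ e).2 h]
    · simp [cutCoeff, h, mt (hZ e).1 h, opVar_opSwap]
  rw [h1]
  by_cases hq : q (Sum.inl (adj i)) = 0
  · rw [disp_equivMapDomain i q hq, ← map_add, vSeq_seqSwap]
  · have h0 : q.prod (cutCoeff Z) = 0 :=
      Finset.prod_eq_zero (Finsupp.mem_support_iff.2 hq) (by simp [cutCoeff, hi, hq])
    rw [h0, zero_smul, zero_smul]

/-- The antisymmetric sequence w_x - t·w_{x+1} sums to zero over the string, as there is no
2-torsion; collecting the coefficient of each w_x gives the relation. -/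
theorem sum_reflection {R M : Type*} [CommRing R] [AddCommGroup M] [Module R M] (t : R)
    (h2 : ∀ x : M, x + x = 0 → x = 0) (w : ℕ → M) (N : ℕ) (hN : 0 < N)
    (h : ∀ x, x < N → w x - t • w (x + 1) = -(w (N - 1 - x) - t • w (N - 1 - x + 1))) :
    w 0 + (1 - t) • ∑ x ∈ Ico 1 N, w x = t • w N := by
  have h0 : ∑ x ∈ range N, (w x - t • w (x + 1)) = 0 := by
    apply h2
    nth_rewrite 1 [Finset.sum_congr rfl fun x hx => h x (Finset.mem_range.1 hx)]
    rw [Finset.sum_neg_distrib, Finset.sum_range_reflect (fun x => w x - t • w (x + 1)) N,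
      neg_add_cancel]
  rw [Finset.sum_sub_distrib, ← Finset.smul_sum] at h0
  have h3 : ∑ x ∈ range N, w x = w 0 + ∑ x ∈ Ico 1 N, w x := by
    rw [Finset.range_eq_Ico, Finset.sum_eq_sum_Ico_succ_bot hN]
  have h4 : ∑ x ∈ range N, w (x + 1) = (∑ x ∈ Ico 1 N, w x) + w N := by
    rw [← Finset.sum_Ico_succ_top hN, Finset.sum_Ico_eq_sum_range]
    simp [add_comm]
  rw [h3, h4] at h0
  rw [← sub_eq_zero, ← h0]
  module

/-- The straightening relation for a pair of adjacent entries in increasing order. -/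
theorem cutV_straighten (Z : Set Ops) (i : ℕ) (hi : Sum.inl (adj i) ∉ Z)
    (hZ : ∀ e, opSwap i e ∈ Z ↔ e ∈ Z) (α : ℕ →₀ ℤ) (N : ℕ) (hN : 0 < N)
    (hα : α i - α (i + 1) = -N) :
    cutV Z α + (1 - tθ) • ∑ x ∈ Ico 1 N, cutV Z (α + x • stepVec (Sum.inl (adj i)))
      = tθ • cutV Z (α + N • stepVec (Sum.inl (adj i))) := by
  set D := stepVec (Sum.inl (adj i)) with hD
  have hZ' : ∀ e, opSwap i e ∈ insert (Sum.inl (adj i)) Z ↔ e ∈ insert (Sum.inl (adj i)) Z := by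
    intro e
    have h1 : opSwap i (Sum.inl (adj i)) = Sum.inl (adj i) := by
      simp [opSwap, pairSwapFun, adj]
    rw [Set.mem_insert_iff, Set.mem_insert_iff, hZ]
    nth_rewrite 1 [← h1]
    rw [EmbeddingLike.apply_eq_iff_eq]
  have hsym := cutV_seqSwap _ i (Set.mem_insert _ Z) hZ'
  -- At α + xD the entries i and i + 1 differ by 2x - N, so exchanging them reflects the string, x ↦
  -- N - x.
  have hsw : ∀ x ≤ N, seqSwap i (α + x • D) = α + (N - x) • D := by
    intro x hx
    ext k
    have h1 : ((N - x : ℕ) : ℤ) = N - x := by push_cast [hx]; ring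
    simp only [seqSwap_apply, Finsupp.add_apply, Finsupp.smul_apply, nsmul_eq_mul, h1, hD, stepVec,
      adj, Finsupp.sub_apply, Finsupp.single_apply, Equiv.swap_apply_def]
    split_ifs <;> first | omega | (subst_vars; simp; try linarith)
  have hex : ∀ β, cutV Z β - tθ • cutV Z (β + D) = cutV (insert (Sum.inl (adj i)) Z) β
      - cutV (insert (Sum.inl (adj i)) Z) (β + D) := by
    intro β
    have h1 := cutV_insert Z _ hi β
    simp only [opVar, Sum.elim_inl, one_smul, one_mul] at h1
    exact h1.symm
  have h2 : ∀ x : Lam, x + x = 0 → x = 0 := by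
    intro x hx
    rw [← two_mul] at hx
    exact (mul_eq_zero.1 hx).resolve_left two_ne_zero
  have hw := sum_reflection tθ h2 (fun x => cutV Z (α + x • D)) N hN (by
    intro x hx
    have e1 : α + (x + 1) • D = α + x • D + D := by rw [succ_nsmul, add_assoc]
    have e2 : α + (N - 1 - x + 1) • D = α + (N - 1 - x) • D + D := by rw [succ_nsmul, add_assoc]
    rw [e1, e2, hex, hex, ← e1, ← e2, ← hsym (α + x • D), ← hsym (α + (x + 1) • D),
      hsw x hx.le, hsw (x + 1) hx, show N - 1 - x + 1 = N - x by omega,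
      show N - (x + 1) = N - 1 - x by omega]
    abel)
  simpa using hw

/-! ### Vanishing -/

theorem stepVec_hi (e : Ops) : stepVec e (hi e) = -1 := by
  rcases e with e | e <;> have := e.2 <;>
    simp [stepVec, hi, this.ne]

theorem stepVec_eq_zero (e : Ops) {J : ℕ} (h : hi e < J) : stepVec e J = 0 := by
  rcases e with e | e <;> have := e.2 <;> simp only [hi, Sum.elim_inl, Sum.elim_inr] at h <;>
    simp [stepVec, h.ne, (this.trans h).ne]

theorem disp_apply_eq_zero (q : Ops →₀ ℕ) {J : ℕ} (h : ∀ e ∈ q.support, hi e < J) :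
    disp q J = 0 := by
  rw [disp_apply]
  exact Finset.sum_eq_zero fun e he => by rw [stepVec_eq_zero e (h e he), mul_zero]

theorem disp_apply_nonpos (q : Ops →₀ ℕ) {J : ℕ} (h : ∀ e ∈ q.support, stepVec e J ≤ 0) :
    disp q J ≤ 0 := by
  rw [disp_apply]
  exact Finset.sum_nonpos fun e he => mul_nonpos_of_nonneg_of_nonpos (by positivity) (h e he)

/-- Among the operators of the monomial, take one reaching furthest to the right: at that position α
is 0 and nothing raises the entry, so it becomes negative. -/
theorem vSeq_add_disp_eq_zero {α : ℕ →₀ ℤ} {N : ℕ} (hα : ∀ J, N ≤ J → α J = 0) (q : Ops →₀ ℕ)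
    {e : Ops} (he : e ∈ q.support) (hN : N ≤ hi e) : vSeq (α + disp q) = 0 := by
  obtain ⟨f, hf, hmax⟩ := q.support.exists_max_image hi ⟨e, he⟩
  refine vSeq_eq_zero (i := hi f) ?_
  rw [Finsupp.add_apply, hα _ (hN.trans (hmax e he)), zero_add, disp_apply]
  have hle : ∀ g ∈ q.support, (q g : ℤ) * stepVec g (hi f) ≤ 0 := by
    intro g hg
    refine mul_nonpos_of_nonneg_of_nonpos (by positivity) ?_
    rcases (hmax g hg).lt_or_eq with h | h
    · rw [stepVec_eq_zero g h]
    · rw [← h, stepVec_hi]; norm_num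
  refine Finset.sum_neg' hle ⟨f, hf, ?_⟩
  rw [stepVec_hi]
  have : 0 < q f := Nat.pos_of_ne_zero (Finsupp.mem_support_iff.1 hf)
  omega

theorem prod_cutCoeff_eq_zero {Z : Set Ops} {q : Ops →₀ ℕ} {e : Ops} (he : e ∈ q.support)
    (hZ : e ∈ Z) : q.prod (cutCoeff Z) = 0 :=
  Finset.prod_eq_zero he (by simp [cutCoeff, hZ, Finsupp.mem_support_iff.1 he])

/-- Monomials reaching past n vanish, those using Z have coefficient zero, and the remaining ones
cannot lift the negative entry at p. -/
theorem cutV_eq_zero (Z : Set Ops) {α : ℕ →₀ ℤ} {n p : ℕ} (hα : ∀ J, n < J → α J = 0)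
    (hp : α p < 0) (hZ : ∀ e, e ∉ Z → hi e ≤ n → stepVec e p ≤ 0) : cutV Z α = 0 := by
  rw [cutV, ← finsum_zero (α := Ops →₀ ℕ)]
  refine finsum_congr fun q => ?_
  by_cases h1 : ∃ e ∈ q.support, n < hi e
  · obtain ⟨e, he, hn⟩ := h1
    rw [vSeq_add_disp_eq_zero (N := n + 1) (fun J hJ => hα J hJ) q he hn, smul_zero]
  by_cases h2 : ∃ e ∈ q.support, e ∈ Z
  · obtain ⟨e, he, hn⟩ := h2
    rw [prod_cutCoeff_eq_zero he hn, zero_smul]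
  push Not at h1 h2
  rw [vSeq_eq_zero (i := p), smul_zero]
  have := disp_apply_nonpos q (J := p) fun e he => hZ e (h2 e he) (h1 e he)
  rw [Finsupp.add_apply]
  omega

/-! ### Adding a row -/

theorem vSeq_add_single {β : ℕ →₀ ℤ} {n : ℕ} (hβ : β n = 0) (r : ℤ) :
    vSeq (β + Finsupp.single n r) = vSeq β * v r := by
  rw [vSeq, Finsupp.prod_add_index_of_disjoint, Finsupp.prod_single_index v_zero]
  · rfl
  · rw [Finset.disjoint_left]
    intro a ha ha'
    have := Finsupp.support_single_subset ha'
    rw [Finset.mem_singleton] at this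
    subst this
    simp [hβ] at ha

/-- With every operator ending at n removed, position n is untouched by the surviving monomials, so
v_r factors out. -/
theorem cutV_add_single (n : ℕ) {α : ℕ →₀ ℤ} (hα : ∀ J, n ≤ J → α J = 0) (r : ℤ) :
    cutV {e | hi e = n} (α + Finsupp.single n r) = Vi α * v r := by
  rw [Vi_eq_cutV, cutV, cutV, finsum_mul' _ _ (finite_support_cutV _ α)]
  refine finsum_congr fun q => ?_
  by_cases h1 : ∃ e ∈ q.support, n ≤ hi e
  · obtain ⟨e, he, hn⟩ := h1
    rw [vSeq_add_disp_eq_zero hα q he hn, smul_zero, zero_mul]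
    rcases hn.lt_or_eq with hn | hn
    · rw [vSeq_add_disp_eq_zero (N := n + 1) _ q he hn, smul_zero]
      intro J hJ
      rw [Finsupp.add_apply, hα J (by omega), Finsupp.single_eq_of_ne (by omega), zero_add]
    · rw [prod_cutCoeff_eq_zero he (by simpa using hn.symm), zero_smul]
  · push Not at h1
    rw [add_right_comm, vSeq_add_single, smul_mul_assoc]
    · congr 1
      refine Finsupp.prod_congr fun e he => ?_
      have : hi e ≠ n := (h1 e he).ne
      simp [cutCoeff, this]
    · rw [Finsupp.add_apply, hα n le_rfl, disp_apply_eq_zero q h1, zero_add]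

/-- The coefficients `1, 1 - e, 1 - e, …`. -/
def stripCoeff {R : Type*} [CommRing R] (e : R) (k : ℕ) : R := if k = 0 then 1 else 1 - e

/-- The hypothesis says (1 - xu)f = (1 - txu)g for the shift u, and (1 - txu)/(1 - xu) = 1 + (1 -
t)∑_{k≥1} x^k u^k. Vanishing at L makes the inversion finite. -/
theorem eq_sum_of_exchange {R M : Type*} [CommRing R] [AddCommGroup M] [Module R M] (x t : R)
    (L : ℕ) (f g : ℕ → M) (hf : f L = 0) (hg : g L = 0)
    (h : ∀ k, f k - x • f (k + 1) = g k - (x * t) • g (k + 1)) :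
    f 0 = ∑ k ∈ range L, (x ^ k * stripCoeff t k) • g k := by
  induction L generalizing f g with
  | zero => simpa using hf
  | succ L ih =>
    have h1 := ih (fun k => f (k + 1)) (fun k => g (k + 1)) hf hg fun k => h (k + 1)
    have h0 := h 0
    simp only [zero_add] at h1 h0
    have h2 : f 0 = x • f 1 + (g 0 - (x * t) • g 1) := by rw [← h0]; abel
    rw [h2, Finset.sum_range_succ', h1, Finset.smul_sum]
    rcases L with _ | L
    · simp [stripCoeff, hg]
    · rw [Finset.sum_range_succ', Finset.sum_range_succ']
      have h3 : ∑ k ∈ range L, x • (x ^ (k + 1) * stripCoeff t (k + 1)) • g (k + 1 + 1)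
          = ∑ k ∈ range L, (x ^ (k + 1 + 1) * stripCoeff t (k + 1 + 1)) • g (k + 1 + 1) := by
        refine Finset.sum_congr rfl fun k _ => ?_
        rw [smul_smul]
        simp only [stripCoeff, Nat.succ_ne_zero, if_false]
        congr 1
        ring
      rw [h3]
      simp only [stripCoeff, Nat.succ_ne_zero, if_false, if_true, pow_zero, zero_add, mul_one,
        one_smul, pow_one]
      module

theorem cutV_insert_eq_sum (Z : Set Ops) (e : Ops) (he : e ∉ Z) {n : ℕ} (hen : hi e = n)
    (hZ : ∀ f, f ∉ Z → hi f ≤ n → stepVec f n ≤ 0) {α : ℕ →₀ ℤ} (hα : ∀ J, n ≤ J → α J = 0)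
    (s : ℕ) :
    cutV (insert e Z) (α + Finsupp.single n (s : ℤ))
      = ∑ p ∈ antidiagonal s, (opVar e ^ p.1 * stripCoeff tθ p.1) •
          cutV Z (α + p.1 • (stepVec e + Finsupp.single n 1) + Finsupp.single n (p.2 : ℤ)) := by
  set β := α + Finsupp.single n (s : ℤ) with hβ
  have hsupp : ∀ J, n < J → (β + (s + 1) • stepVec e) J = 0 := by
    intro J hJ
    simp [hβ, hα J hJ.le, stepVec_eq_zero e (hen.trans_lt hJ), Finsupp.single_eq_of_ne hJ.ne']
  have hneg : (β + (s + 1) • stepVec e) n < 0 := by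
    have h := stepVec_hi e
    rw [hen] at h
    simp [hβ, hα n le_rfl, h]
  -- Each use of `e` lowers entry n by one, so after s + 1 uses it is negative and both sides
  -- vanish.
  have h := eq_sum_of_exchange (opVar e) tθ (s + 1) (fun k => cutV (insert e Z) (β + k • stepVec e))
    (fun k => cutV Z (β + k • stepVec e))
    (cutV_eq_zero _ hsupp hneg fun f hf hf' => hZ f (fun h => hf (Set.mem_insert_of_mem _ h)) hf')
    (cutV_eq_zero _ hsupp hneg hZ)
    (fun k => by
      have := cutV_insert Z e he (β + k • stepVec e)
      simp only [succ_nsmul, ← add_assoc]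
      exact this)
  simp only [zero_smul, add_zero] at h
  rw [h, Finset.Nat.sum_antidiagonal_eq_sum_range_succ_mk]
  refine Finset.sum_congr rfl fun k hk => ?_
  have hk' : k ≤ s := Nat.lt_succ_iff.1 (Finset.mem_range.1 hk)
  congr 2
  rw [hβ, Nat.cast_sub hk', Finsupp.single_sub, nsmul_add, Finsupp.smul_single, nsmul_eq_mul,
    mul_one]
  abel

/-! ### Sums over compositions -/

theorem sum_antidiagonal_assoc {M : Type*} [AddCommMonoid M] (k : ℕ) (f : ℕ → ℕ → ℕ → M) :
    ∑ p ∈ antidiagonal k, ∑ q ∈ antidiagonal p.2, f p.1 q.1 q.2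
      = ∑ p ∈ antidiagonal k, ∑ q ∈ antidiagonal p.1, f q.1 q.2 p.2 := by
  rw [Finset.sum_sigma', Finset.sum_sigma']
  refine Finset.sum_bij' (fun x _ => ⟨(x.1.1 + x.2.1, x.2.2), (x.1.1, x.2.1)⟩)
    (fun x _ => ⟨(x.2.1, x.2.2 + x.1.2), (x.2.2, x.1.2)⟩) ?_ ?_ ?_ ?_ ?_
  · rintro ⟨⟨a, b⟩, ⟨c, d⟩⟩ h
    simp only [mem_sigma, HasAntidiagonal.mem_antidiagonal] at h ⊢
    exact ⟨by omega, trivial⟩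
  · rintro ⟨⟨a, b⟩, ⟨c, d⟩⟩ h
    simp only [mem_sigma, HasAntidiagonal.mem_antidiagonal] at h ⊢
    exact ⟨by omega, trivial⟩
  · rintro ⟨⟨a, b⟩, ⟨c, d⟩⟩ h
    simp only [mem_sigma, HasAntidiagonal.mem_antidiagonal] at h
    obtain ⟨-, rfl⟩ := h
    rfl
  · rintro ⟨⟨a, b⟩, ⟨c, d⟩⟩ h
    simp only [mem_sigma, HasAntidiagonal.mem_antidiagonal] at h
    obtain ⟨-, rfl⟩ := h
    rfl
  · rintro ⟨⟨a, b⟩, ⟨c, d⟩⟩ h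
    rfl

theorem eq_zero_of_mem_finsuppAntidiag {s : Finset ℕ} {k a : ℕ} {γ : ℕ →₀ ℕ}
    (h : γ ∈ finsuppAntidiag s k) (ha : a ∉ s) : γ a = 0 := by
  rw [mem_finsuppAntidiag] at h
  by_contra h0
  exact ha (h.2 (Finsupp.mem_support_iff.2 h0))

theorem sum_finsuppAntidiag_insert {M : Type*} [AddCommMonoid M] {s : Finset ℕ} {a : ℕ}
    (ha : a ∉ s) (k : ℕ) (f : (ℕ →₀ ℕ) → M) :
    ∑ γ ∈ finsuppAntidiag (insert a s) k, f γ
      = ∑ p ∈ antidiagonal k, ∑ γ ∈ finsuppAntidiag s p.2, f (γ + Finsupp.single a p.1) := by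
  rw [Finset.sum_sigma']
  have herase : ∀ γ : ℕ →₀ ℕ, ∑ i ∈ s, γ.erase a i = ∑ i ∈ s, γ i := fun γ =>
    Finset.sum_congr rfl fun i hi => by
      rw [Finsupp.erase_ne (ne_of_mem_of_not_mem hi ha)]
  refine Finset.sum_bij' (fun γ _ => ⟨(γ a, k - γ a), γ.erase a⟩)
    (fun x _ => x.2 + Finsupp.single a x.1.1) ?_ ?_ ?_ ?_ ?_
  · intro γ h
    rw [mem_finsuppAntidiag, Finset.sum_insert ha] at h
    simp only [mem_sigma, HasAntidiagonal.mem_antidiagonal, mem_finsuppAntidiag, herase, Finsupp.support_erase]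
    refine ⟨by omega, by omega, ?_⟩
    rw [← Finset.subset_insert_iff]
    exact h.2
  · rintro ⟨⟨i, j⟩, γ⟩ h
    simp only [mem_sigma, HasAntidiagonal.mem_antidiagonal] at h
    have h0 := eq_zero_of_mem_finsuppAntidiag h.2 ha
    rw [mem_finsuppAntidiag] at h ⊢
    refine ⟨?_, ?_⟩
    · rw [Finset.sum_insert ha]
      have : ∑ x ∈ s, (γ + Finsupp.single a i) x = ∑ x ∈ s, γ x :=
        Finset.sum_congr rfl fun x hx => by
          simp [Finsupp.single_eq_of_ne (ne_of_mem_of_not_mem hx ha)]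
      rw [this]
      simp [h0, h.2.1, h.1]
    · refine Finsupp.support_add.trans (Finset.union_subset ?_ ?_)
      · exact h.2.2.trans (Finset.subset_insert _ _)
      · exact Finsupp.support_single_subset.trans (by simp)
  · intro γ h
    exact Finsupp.erase_add_single a γ
  · rintro ⟨⟨i, j⟩, γ⟩ h
    simp only [mem_sigma, HasAntidiagonal.mem_antidiagonal] at h
    have h0 := eq_zero_of_mem_finsuppAntidiag h.2 ha
    obtain ⟨rfl, -⟩ := h
    have h1 : (γ + Finsupp.single a i).erase a = γ := by
      ext x
      rcases eq_or_ne x a with rfl | hx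
      · simp [h0]
      · simp [hx]
    simp [h0, h1]
  · intro γ h
    rw [Finsupp.erase_add_single a γ]

/-- The combination `∑ γ_i u_i`. -/
def comb {Γ : Type*} [AddCommMonoid Γ] (u : ℕ → Γ) : (ℕ →₀ ℕ) →+ Γ :=
  Finsupp.liftAddHom fun i => multiplesHom Γ (u i)

theorem comb_single {Γ : Type*} [AddCommMonoid Γ] (u : ℕ → Γ) (i k : ℕ) :
    comb u (Finsupp.single i k) = k • u i := by
  simp [comb]

theorem comb_eq_sum {Γ : Type*} [AddCommMonoid Γ] (u : ℕ → Γ) (γ : ℕ →₀ ℕ) :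
    comb u γ = ∑ i ∈ γ.support, γ i • u i := by
  rw [comb, Finsupp.liftAddHom_apply]
  rfl

theorem prod_add_single {R : Type*} [CommMonoid R] (d : ℕ → R) {s : Finset ℕ} {a : ℕ}
    (ha : a ∉ s) (γ : ℕ →₀ ℕ) (k : ℕ) :
    ∏ i ∈ s, d ((γ + Finsupp.single a k) i) = ∏ i ∈ s, d (γ i) :=
  Finset.prod_congr rfl fun i hi => by
    simp [Finsupp.single_eq_of_ne (ne_of_mem_of_not_mem hi ha)]

/-! ### Straightening -/

section Straighten

variable {R M Γ : Type*} [CommRing R] [AddCommGroup M] [Module R M] [AddCommGroup Γ]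

/-- The parameter of the next row, when `k` out of `g` possible boxes are used. -/
def nextParam (t e : R) (g k : ℕ) : R := if k < g then t else if g = 0 then t * e else 0

theorem stripCoeff_zero (e : R) : stripCoeff e 0 = 1 := by simp [stripCoeff]

/-- Here `w x` is the term with x of the k boxes in the second row. The terms with more than g boxes
in the first row sum to (1 - e) times the left side of `hw`, hence to (1 - e)t·w(k - g). This joins
the term with exactly g boxes in the first row: for g > 0 its coefficient becomes (1 - e)(1 - t) +
(1 - e)t = 1 - e, so the next parameter is 0; for g = 0 it becomes (1 - t) + (1 - e)t = 1 - te. -/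
theorem straighten_two_rows (t e : R) (g k : ℕ) (w : ℕ → M)
    (hw : g < k → w 0 + (1 - t) • ∑ x ∈ Ico 1 (k - g), w x = t • w (k - g)) :
    ∑ q ∈ antidiagonal k, (stripCoeff e q.1 * stripCoeff t q.2) • w q.2
      = ∑ q ∈ antidiagonal k, ((if q.1 ≤ g then stripCoeff e q.1 else 0)
          * stripCoeff (nextParam t e g q.1) q.2) • w q.2 := by
  rcases lt_or_ge g k with hgk | hgk
  · obtain ⟨N, rfl⟩ := Nat.exists_eq_add_of_lt hgk
    have hN : g + N + 1 - g = N + 1 := by omega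
    have h1 := hw hgk
    rw [hN] at h1
    rw [← Finset.Nat.sum_antidiagonal_swap, ← Finset.Nat.sum_antidiagonal_swap (f := fun q =>
      ((if q.1 ≤ g then stripCoeff e q.1 else 0) * stripCoeff (nextParam t e g q.1) q.2) • w q.2),
      Finset.Nat.sum_antidiagonal_eq_sum_range_succ_mk,
      Finset.Nat.sum_antidiagonal_eq_sum_range_succ_mk]
    simp only [Prod.swap, Nat.succ_eq_add_one]
    rw [show g + N + 1 + 1 = (N + 1) + (g + 1) by ring, Finset.sum_range_add _ (N + 1),
      Finset.sum_range_add _ (N + 1), Finset.sum_range_succ' _ g, Finset.sum_range_succ' _ g]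
    have hA : ∑ x ∈ range (N + 1), (stripCoeff e (g + N + 1 - x) * stripCoeff t x) • w x
        = (1 - e) • (w 0 + (1 - t) • ∑ x ∈ Ico 1 (N + 1), w x) := by
      rw [Finset.range_eq_Ico, Finset.sum_eq_sum_Ico_succ_bot (Nat.succ_pos N), smul_add,
        Finset.smul_sum, Finset.smul_sum]
      congr 1
      · simp [stripCoeff]
      · refine Finset.sum_congr rfl fun x hx => ?_
        rw [Finset.mem_Ico] at hx
        rw [smul_smul]
        simp only [stripCoeff]
        rw [if_neg (by omega), if_neg (by omega)]
    have hB : ∑ x ∈ range (N + 1), ((if g + N + 1 - x ≤ g then stripCoeff e (g + N + 1 - x) else 0)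
        * stripCoeff (nextParam t e g (g + N + 1 - x)) x) • w x = 0 := by
      refine Finset.sum_eq_zero fun x hx => ?_
      rw [Finset.mem_range] at hx
      rw [if_neg (by omega), zero_mul, zero_smul]
    have hC : ∀ x ∈ range g, (stripCoeff e (g + N + 1 - (N + 1 + (x + 1)))
          * stripCoeff t (N + 1 + (x + 1))) • w (N + 1 + (x + 1))
        = ((if g + N + 1 - (N + 1 + (x + 1)) ≤ g then
            stripCoeff e (g + N + 1 - (N + 1 + (x + 1))) else 0)
          * stripCoeff (nextParam t e g (g + N + 1 - (N + 1 + (x + 1)))) (N + 1 + (x + 1)))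
          • w (N + 1 + (x + 1)) := by
      intro x hx
      rw [Finset.mem_range] at hx
      rw [if_pos (by omega), nextParam, if_pos (by omega)]
    rw [hA, hB, h1, Finset.sum_congr rfl hC, zero_add, add_left_comm]
    congr 1
    rw [add_zero, show g + N + 1 - (N + 1) = g by omega, if_pos le_rfl, smul_smul, ← add_smul]
    congr 1
    rcases Nat.eq_zero_or_pos g with rfl | hg
    · simp [stripCoeff, nextParam]
      ring
    · simp [stripCoeff, nextParam, hg.ne']
      ring
  · refine Finset.sum_congr rfl fun q hq => ?_
    rw [HasAntidiagonal.mem_antidiagonal] at hq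
    rw [if_pos (by omega)]
    rcases Nat.lt_or_ge q.1 g with h | h
    · rw [nextParam, if_pos h]
    -- When the first row is filled and no box is left, the next parameter is immaterial.
    · rw [show q.2 = 0 by omega, stripCoeff_zero, stripCoeff_zero]

/-- The coefficient of a choice `γ` of numbers of boxes in the rows `j, …, j + r - 1`, with at most
`g_i` boxes in each row `i` but the last. -/
def rowProd (t : R) (g : ℕ → ℕ) : ℕ → ℕ → R → (ℕ → ℕ) → R
  | 0, _, _, _ => 1
  | 1, j, e, γ => stripCoeff e (γ j)
  | r + 2, j, e, γ => (if γ j ≤ g j then stripCoeff e (γ j) else 0)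
      * rowProd t g (r + 1) (j + 1) (nextParam t e (g j) (γ j)) γ

theorem rowProd_congr (t : R) (g : ℕ → ℕ) (r j : ℕ) (e : R) {γ γ' : ℕ → ℕ}
    (h : ∀ i, j ≤ i → γ i = γ' i) : rowProd t g r j e γ = rowProd t g r j e γ' := by
  induction r using Nat.twoStepInduction generalizing j e with
  | zero => rfl
  | one => simp [rowProd, h j le_rfl]
  | more r _ ih =>
    rw [rowProd, rowProd, h j le_rfl, ih _ _ fun i hi => h i (by omega)]

open scoped Classical in
theorem rowProd_eq (t : R) (g : ℕ → ℕ) (r j : ℕ) (E : ℕ → R) (γ : ℕ → ℕ)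
    (hE : ∀ i, E (i + 1) = nextParam t (E i) (g i) (γ i)) :
    rowProd t g r j (E j) γ
      = if ∀ i, j ≤ i → i + 1 < j + r → γ i ≤ g i then
          ∏ i ∈ Ico j (j + r), stripCoeff (E i) (γ i) else 0 := by
  induction r using Nat.twoStepInduction generalizing j with
  | zero =>
    rw [if_pos fun i h1 h2 => by omega]
    simp [rowProd]
  | one =>
    rw [if_pos fun i h1 h2 => by omega]
    simp [rowProd]
  | more r _ ih =>
    rw [rowProd, ← hE, ih, Finset.prod_eq_prod_Ico_succ_bot (by omega : j < j + (r + 2))]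
    have h1 : (∀ i, j ≤ i → i + 1 < j + (r + 2) → γ i ≤ g i)
        ↔ γ j ≤ g j ∧ ∀ i, j + 1 ≤ i → i + 1 < j + 1 + (r + 1) → γ i ≤ g i := by
      constructor
      · exact fun h => ⟨h j le_rfl (by omega), fun i h1 h2 => h i (by omega) (by omega)⟩
      · rintro ⟨h0, h⟩ i h1 h2
        rcases h1.eq_or_lt with rfl | h1
        · exact h0
        · exact h i h1 (by omega)
    rw [show j + 1 + (r + 1) = j + (r + 2) by ring] at h1 ⊢
    simp only [h1]
    by_cases h2 : γ j ≤ g j <;> simp [h2]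

/-- Adding `u i` closes the gap between row i and the next row in the sweep by one, and `u (i + 1)`
reopens it. Induction on the number of rows: straighten the first two, fix the content of the first,
and continue with the new parameter. Being abstract in the `u i`, it serves removal downwards and
addition upwards alike. -/
theorem straighten (t : R) (u : ℕ → Γ) (gap : ℕ → Γ →+ ℤ) (g : ℕ → ℕ) (m : ℕ) (W : Γ → M)
    (hu0 : ∀ i, i + 1 < m → gap i (u i) = -1) (hu1 : ∀ i, i + 1 < m → gap i (u (i + 1)) = 1)
    (hu : ∀ i l, i + 1 < m → l < m → l ≠ i → l ≠ i + 1 → gap i (u l) = 0)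
    (hW : ∀ i, i + 1 < m → ∀ (β : Γ) (N : ℕ), 0 < N → gap i β = -N →
      W β + (1 - t) • ∑ x ∈ Ico 1 N, W (β + x • (u (i + 1) - u i))
        = t • W (β + N • (u (i + 1) - u i)))
    (r j : ℕ) (hr : j + r = m) (e : R) (k : ℕ) (α : Γ)
    (hα : ∀ i, j ≤ i → i + 1 < m → gap i α = g i) :
    ∑ γ ∈ finsuppAntidiag (Ico j m) k,
        (stripCoeff e (γ j) * ∏ i ∈ Ico (j + 1) m, stripCoeff t (γ i)) • W (α + comb u γ)
      = ∑ γ ∈ finsuppAntidiag (Ico j m) k, rowProd t g r j e γ • W (α + comb u γ) := by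
  induction r using Nat.twoStepInduction generalizing j e k α with
  | zero =>
    obtain rfl : j = m := by omega
    refine Finset.sum_congr rfl fun γ hγ => ?_
    rw [eq_zero_of_mem_finsuppAntidiag hγ (by simp)]
    simp [rowProd, stripCoeff]
  | one =>
    subst hr
    simp [rowProd]
  | more r _ ih =>
    have hIco : ∀ l, l < m → Ico l m = insert l (Ico (l + 1) m) := fun l hl =>
      (Finset.insert_Ico_add_one_left_eq_Ico hl).symm
    have hnot : ∀ l, l ∉ Ico (l + 1) m := by simp
    have hjm : j + 1 < m := by omega
    -- Regroup by the total `P.1` of boxes in rows j and j + 1 and by the content δ of the later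
    -- rows. Starting with all `P.1` boxes in row j, `q.2` of them are moved to row j + 1.
    have expand : ∀ (c E : ℕ → R),
        ∑ p ∈ antidiagonal k, ∑ γ ∈ finsuppAntidiag (Ico (j + 1) m) p.2,
          (c p.1 * (stripCoeff (E p.1) (γ (j + 1))
            * ∏ i ∈ Ico (j + 2) m, stripCoeff t (γ i))) • W (α + p.1 • u j + comb u γ)
        = ∑ P ∈ antidiagonal k, ∑ δ ∈ finsuppAntidiag (Ico (j + 2) m) P.2,
            (∏ i ∈ Ico (j + 2) m, stripCoeff t (δ i)) • ∑ q ∈ antidiagonal P.1,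
              (c q.1 * stripCoeff (E q.1) q.2)
                • W (α + comb u δ + P.1 • u j + q.2 • (u (j + 1) - u j)) := by
      intro c E
      rw [hIco (j + 1) hjm]
      simp_rw [sum_finsuppAntidiag_insert (hnot (j + 1))]
      rw [sum_antidiagonal_assoc k fun a b l => ∑ x ∈ finsuppAntidiag (Ico (j + 1 + 1) m) l,
        (c a * (stripCoeff (E a) ((x + Finsupp.single (j + 1) b) (j + 1))
          * ∏ i ∈ Ico (j + 2) m, stripCoeff t ((x + Finsupp.single (j + 1) b) i)))
            • W (α + a • u j + comb u (x + Finsupp.single (j + 1) b))]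
      refine Finset.sum_congr rfl fun P _ => ?_
      rw [Finset.sum_comm]
      refine Finset.sum_congr rfl fun δ hδ => ?_
      rw [Finset.smul_sum]
      refine Finset.sum_congr rfl fun q hq => ?_
      rw [HasAntidiagonal.mem_antidiagonal] at hq
      rw [smul_smul, prod_add_single _ (hnot (j + 1)), map_add (comb u), comb_single, Finsupp.add_apply,
        eq_zero_of_mem_finsuppAntidiag hδ (hnot (j + 1)), Finsupp.single_eq_same, zero_add, ← hq]
      congr 1
      · ring
      · congr 1
        rw [add_nsmul, nsmul_sub]
        abel
    rw [hIco j (by omega), sum_finsuppAntidiag_insert (hnot j), sum_finsuppAntidiag_insert (hnot j)]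
    have hL := expand (stripCoeff e) fun _ => t
    have hR := expand (fun a => if a ≤ g j then stripCoeff e a else 0)
      fun a => nextParam t e (g j) a
    refine Eq.trans ?_ (hL.trans (Eq.trans ?_ (hR.symm.trans ?_)))
    · refine Finset.sum_congr rfl fun p _ => Finset.sum_congr rfl fun γ hγ => ?_
      rw [map_add, comb_single, Finsupp.add_apply, eq_zero_of_mem_finsuppAntidiag hγ (hnot j),
        Finsupp.single_eq_same, zero_add, prod_add_single _ (hnot j), hIco (j + 1) hjm,
        Finset.prod_insert (hnot (j + 1)), ← add_assoc, add_right_comm α]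
    · refine Finset.sum_congr rfl fun P _ => Finset.sum_congr rfl fun δ hδ => ?_
      congr 1
      refine straighten_two_rows t e (g j) P.1 (fun y =>
        W (α + comb u δ + P.1 • u j + y • (u (j + 1) - u j))) fun hlt => ?_
      have hgap : gap j (α + comb u δ + P.1 • u j) = -((P.1 - g j : ℕ) : ℤ) := by
        have hδ0 : gap j (comb u δ) = 0 := by
          rw [comb_eq_sum, map_sum]
          refine Finset.sum_eq_zero fun i hi => ?_
          have hi' := (mem_finsuppAntidiag.1 hδ).2 hi
          rw [Finset.mem_Ico] at hi'
          rw [map_nsmul, hu j i hjm hi'.2 (by omega) (by omega), smul_zero]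
        rw [map_add, map_add, hα j le_rfl hjm, hδ0, map_nsmul, hu0 j hjm, Nat.cast_sub hlt.le]
        simp only [nsmul_eq_mul]
        ring
      have := hW j hjm _ _ (Nat.sub_pos_of_lt hlt) hgap
      simpa using this
    · refine Finset.sum_congr rfl fun p _ => ?_
      have h1 := ih (j + 1) (by omega) (nextParam t e (g j) p.1) p.2 (α + p.1 • u j) (by
        intro i hi him
        rw [map_add, map_nsmul, hα i (by omega) him, hu i j him (by omega) (by omega) (by omega),
          smul_zero, add_zero])
      simp_rw [mul_smul _ (_ * _)]
      rw [← Finset.smul_sum, h1, Finset.smul_sum]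
      refine Finset.sum_congr rfl fun γ hγ => ?_
      rw [map_add, comb_single, rowProd, Finsupp.add_apply,
        eq_zero_of_mem_finsuppAntidiag hγ (hnot j), Finsupp.single_eq_same, zero_add, smul_smul,
        ← add_assoc, add_right_comm α]
      congr 2
      refine rowProd_congr _ _ _ _ _ fun i hi => ?_
      simp [Finsupp.single_eq_of_ne (show i ≠ j by omega)]

end Straighten

/-! ### Expansions in the added row -/

/-- The operators `R_{in}` with `n - m ≤ i < n`. -/
def raiseOps (n m : ℕ) : Set Ops :=
  {e | Sum.elim (fun p : Pairs => p.1.2 = n ∧ n ≤ p.1.1 + m) (fun _ => False) e}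

/-- The operators `R_{in}` with `i < n`, and `L_{in}` with `i < m`. -/
def raiseLowerOps (n m : ℕ) : Set Ops :=
  {e | Sum.elim (fun p : Pairs => p.1.2 = n) (fun p => p.1.2 = n ∧ p.1.1 < m) e}

theorem raiseOps_zero (n : ℕ) : raiseOps n 0 = ∅ := by
  ext e
  rcases e with e | e
  · have := e.2
    simp only [raiseOps, Set.mem_ofPred_eq, Sum.elim_inl, Set.mem_empty_iff_false, iff_false]
    omega
  · simp [raiseOps]

theorem raiseOps_succ {n m : ℕ} (h : n - (m + 1) < n) (hm : m + 1 ≤ n) :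
    raiseOps n (m + 1) = insert (Sum.inl ⟨(n - (m + 1), n), h⟩) (raiseOps n m) := by
  ext e
  rcases e with ⟨⟨a, b⟩, hab⟩ | e
  · simp only [raiseOps, Set.mem_ofPred_eq, Sum.elim_inl, Set.mem_insert_iff, Sum.inl.injEq,
      Subtype.mk.injEq, Prod.mk.injEq]
    simp only at hab
    omega
  · simp [raiseOps]

theorem raiseLowerOps_zero (n : ℕ) : raiseLowerOps n 0 = raiseOps n n := by
  ext e
  rcases e with e | e <;> simp [raiseOps, raiseLowerOps]

theorem raiseLowerOps_self (n : ℕ) : raiseLowerOps n n = {e | hi e = n} := by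
  ext e
  rcases e with e | e
  · simp [raiseLowerOps, hi]
  · have := e.2
    simp only [raiseLowerOps, Set.mem_ofPred_eq, Sum.elim_inr, hi]
    omega

theorem raiseLowerOps_succ {n m : ℕ} (h : m < n) :
    raiseLowerOps n (m + 1) = insert (Sum.inr ⟨(m, n), h⟩) (raiseLowerOps n m) := by
  ext e
  rcases e with e | ⟨⟨a, b⟩, hab⟩
  · simp [raiseLowerOps]
  · simp only [raiseLowerOps, Set.mem_ofPred_eq, Sum.elim_inr, Set.mem_insert_iff, Sum.inr.injEq,
      Subtype.mk.injEq, Prod.mk.injEq]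
    simp only at hab
    omega

theorem stepVec_apply_nonpos {e : Ops} {n : ℕ} (h : hi e ≤ n) : stepVec e n ≤ 0 := by
  rcases h.lt_or_eq with h | rfl
  · rw [stepVec_eq_zero e h]
  · rw [stepVec_hi]; norm_num

/-- The factors are put back one at a time. Here `γ i` is the number of boxes in row n - i, and `γ
0`, what stays in the new row, carries no coefficient. -/
theorem cutV_raiseOps {n m : ℕ} (hm : m ≤ n) {α : ℕ →₀ ℤ} (hα : ∀ J, n ≤ J → α J = 0) (s : ℕ) :
    cutV (raiseOps n m) (α + Finsupp.single n (s : ℤ))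
      = ∑ γ ∈ finsuppAntidiag (Ico 0 (m + 1)) s, (∏ i ∈ Ico 1 (m + 1), stripCoeff tθ (γ i)) •
          cutV ∅ (α + comb (fun i => Finsupp.single (n - i) (1 : ℤ)) γ) := by
  induction m generalizing α s with
  | zero =>
    rw [raiseOps_zero, show Ico 0 (0 + 1) = insert 0 ∅ by simp,
      sum_finsuppAntidiag_insert (by simp), Finset.sum_eq_single (s, 0)]
    · simp [comb_single]
    · rintro ⟨a, b⟩ hp hne
      rw [HasAntidiagonal.mem_antidiagonal] at hp
      rw [finsuppAntidiag_empty_of_ne_zero, Finset.sum_empty]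
      rintro rfl
      exact hne (Prod.ext (by simpa using hp) rfl)
    · intro h
      exact absurd (by simp) h
  | succ m ih =>
    have hlt : n - (m + 1) < n := by omega
    have hIco : ∀ l, l ≤ m + 1 → Ico l (m + 1 + 1) = insert (m + 1) (Ico l (m + 1)) := fun l hl =>
      (Finset.insert_Ico_right_eq_Ico_add_one hl).symm
    have hnot : ∀ l, m + 1 ∉ Ico l (m + 1) := by simp
    rw [raiseOps_succ hlt hm, cutV_insert_eq_sum (n := n) _ _ ?_ rfl ?_ hα, hIco 0 (by omega),
      hIco 1 (by omega), sum_finsuppAntidiag_insert (hnot 0)]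
    · refine Finset.sum_congr rfl fun p _ => ?_
      have hv : stepVec (Sum.inl ⟨(n - (m + 1), n), hlt⟩) + Finsupp.single n 1
          = Finsupp.single (n - (m + 1)) 1 := by
        simp [stepVec]
      rw [hv, ih (by omega), Finset.smul_sum]
      · refine Finset.sum_congr rfl fun γ hγ => ?_
        rw [map_add, comb_single, smul_smul, Finset.prod_insert (hnot 1),
          prod_add_single _ (hnot 1), Finsupp.add_apply,
          eq_zero_of_mem_finsuppAntidiag hγ (hnot 0), Finsupp.single_eq_same, zero_add, add_right_comm,
          ← add_assoc]
        simp [opVar]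
      · intro J hJ
        simp [hα J hJ, Finsupp.single_eq_of_ne (show J ≠ n - (m + 1) by omega)]
    · simp only [raiseOps, Set.mem_ofPred_eq, Sum.elim_inl]
      omega
    · exact fun f _ hf => stepVec_apply_nonpos hf

/-- The L_{in} are put back first, all R_{in} still missing: θ^a records the a boxes removed, and b
units remain in position n for the raising phase. -/
theorem cutV_raiseLowerOps {n m : ℕ} (hm : m ≤ n) {α : ℕ →₀ ℤ} (hα : ∀ J, n ≤ J → α J = 0)
    (r : ℕ) :
    cutV (raiseLowerOps n m) (α + Finsupp.single n (r : ℤ))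
      = ∑ ab ∈ antidiagonal r, θ ^ ab.1 •
          ∑ γ ∈ finsuppAntidiag (Ico 0 m) ab.1, (∏ i ∈ Ico 0 m, stripCoeff tθ (γ i)) •
            cutV (raiseOps n n) (α + comb (fun i => -Finsupp.single i (1 : ℤ)) γ
              + Finsupp.single n (ab.2 : ℤ)) := by
  induction m generalizing α r with
  | zero =>
    rw [raiseLowerOps_zero, Finset.sum_eq_single (0, r)]
    · simp
    · rintro ⟨a, b⟩ hp hne
      rw [HasAntidiagonal.mem_antidiagonal] at hp
      rw [Ico_self, finsuppAntidiag_empty_of_ne_zero, Finset.sum_empty, smul_zero]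
      rintro rfl
      exact hne (Prod.ext rfl (by simpa using hp))
    · intro h
      exact absurd (by simp) h
  | succ m ih =>
    have hlt : m < n := hm
    have hIco : Ico 0 (m + 1) = insert m (Ico 0 m) :=
      (Finset.insert_Ico_right_eq_Ico_add_one (Nat.zero_le m)).symm
    have hnot : m ∉ Ico 0 m := by simp
    rw [raiseLowerOps_succ hlt, cutV_insert_eq_sum (n := n) _ _ ?_ rfl ?_ hα, hIco]
    · have hv : stepVec (Sum.inr ⟨(m, n), hlt⟩) + Finsupp.single n 1
          = -Finsupp.single m 1 := by
        simp [stepVec]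
      simp_rw [sum_finsuppAntidiag_insert hnot, hv]
      have hsum : ∀ p ∈ antidiagonal r,
          (opVar (Sum.inr ⟨(m, n), hlt⟩) ^ p.1 * stripCoeff tθ p.1) •
            cutV (raiseLowerOps n m) (α + p.1 • -Finsupp.single m 1 + Finsupp.single n (p.2 : ℤ))
          = ∑ q ∈ antidiagonal p.2, (θ ^ p.1 * stripCoeff tθ p.1) • θ ^ q.1 •
              ∑ γ ∈ finsuppAntidiag (Ico 0 m) q.1, (∏ i ∈ Ico 0 m, stripCoeff tθ (γ i)) •
                cutV (raiseOps n n) (α + p.1 • -Finsupp.single m 1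
                  + comb (fun i => -Finsupp.single i (1 : ℤ)) γ + Finsupp.single n (q.2 : ℤ)) := by
        intro p _
        rw [ih hlt.le, Finset.smul_sum]
        · rfl
        · intro J hJ
          simp [hα J hJ, Finsupp.single_eq_of_ne (show J ≠ m by omega)]
      rw [Finset.sum_congr rfl hsum, sum_antidiagonal_assoc r fun a b c =>
        (θ ^ a * stripCoeff tθ a) • θ ^ b •
              ∑ γ ∈ finsuppAntidiag (Ico 0 m) b, (∏ i ∈ Ico 0 m, stripCoeff tθ (γ i)) •
                cutV (raiseOps n n) (α + a • -Finsupp.single m 1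
                  + comb (fun i => -Finsupp.single i (1 : ℤ)) γ + Finsupp.single n (c : ℤ))]
      refine Finset.sum_congr rfl fun p _ => ?_
      rw [Finset.smul_sum]
      refine Finset.sum_congr rfl fun q hq => ?_
      rw [HasAntidiagonal.mem_antidiagonal] at hq
      rw [← hq, smul_smul, Finset.smul_sum, Finset.smul_sum]
      refine Finset.sum_congr rfl fun γ hγ => ?_
      rw [map_add, comb_single, Finset.prod_insert hnot, prod_add_single _ hnot, Finsupp.add_apply,
        eq_zero_of_mem_finsuppAntidiag hγ hnot, Finsupp.single_eq_same, zero_add, smul_smul,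
        smul_smul, ← add_assoc, add_right_comm α]
      congr 1
      ring
    · simp [raiseLowerOps]
    · exact fun f _ hf => stepVec_apply_nonpos hf

/-! ### Straightening the expansions -/

/-- The difference of the entries in positions `i` and `i + 1`. -/
def gapHom (i : ℕ) : (ℕ →₀ ℤ) →+ ℤ := Finsupp.applyAddHom i - Finsupp.applyAddHom (i + 1)

theorem gapHom_apply (i : ℕ) (α : ℕ →₀ ℤ) : gapHom i α = α i - α (i + 1) := rfl

/-- Straightening the removed rows while all R_{in} are missing requires that set to be stable under
exchanges away from n. -/
theorem opSwap_mem_raiseOps {n i : ℕ} (hi : i + 1 < n) (e : Ops) :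
    opSwap i e ∈ raiseOps n n ↔ e ∈ raiseOps n n := by
  rcases e with ⟨⟨a, b⟩, hab⟩ | e
  · simp only [raiseOps, opSwap, Equiv.sumCongr_apply, Sum.map_inl, Set.mem_ofPred_eq, Sum.elim_inl,
      Function.Involutive.coe_toPerm, le_add_iff_nonneg_left, zero_le, and_true, pairSwapFun]
    split_ifs with h
    · rfl
    · rw [Equiv.swap_apply_eq_iff, Equiv.swap_apply_of_ne_of_ne (by omega) (by omega)]
  · simp [raiseOps, opSwap]

theorem sum_raise_straighten (n : ℕ) (f : ℕ → ℕ) (hf : Antitone f) {α : ℕ →₀ ℤ}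
    (hα : ∀ i, α i = f i) (hn : f n = 0) (s : ℕ) :
    cutV (raiseOps n n) (α + Finsupp.single n (s : ℤ))
      = ∑ γ ∈ finsuppAntidiag (Ico 0 (n + 1)) s,
          rowProd tθ (fun i => f (n - (i + 1)) - f (n - i)) (n + 1) 0 0 γ •
            Vi (α + comb (fun i => Finsupp.single (n - i) (1 : ℤ)) γ) := by
  have hα0 : ∀ J, n ≤ J → α J = 0 := by
    intro J hJ
    have := hf hJ
    rw [hα, show f J = 0 by omega, Nat.cast_zero]
  have h := straighten tθ (fun i => Finsupp.single (n - i) (1 : ℤ)) (fun i => gapHom (n - (i + 1)))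
    (fun i => f (n - (i + 1)) - f (n - i)) (n + 1) (cutV ∅) ?_ ?_ ?_ ?_ (n + 1) 0 (by omega) 0 s α ?_
  · rw [cutV_raiseOps le_rfl hα0]
    simp_rw [Vi_eq_cutV]
    rw [← h]
    refine Finset.sum_congr rfl fun γ _ => ?_
    congr 1
    -- Starting the sweep with parameter 0 encodes the coefficient 1 of the new row.
    simp [stripCoeff]
  · intro i hi
    rw [gapHom_apply, show n - (i + 1) + 1 = n - i by omega, Finsupp.single_eq_same,
      Finsupp.single_eq_of_ne (by omega)]
    norm_num
  · intro i hi
    rw [gapHom_apply, Finsupp.single_eq_same, Finsupp.single_eq_of_ne (by omega)]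
    norm_num
  · intro i l hi hl h1 h2
    rw [gapHom_apply, Finsupp.single_eq_of_ne (by omega), Finsupp.single_eq_of_ne (by omega)]
    norm_num
  · intro i hi β N hN hgap
    have hv : stepVec (Sum.inl (adj (n - (i + 1))))
        = Finsupp.single (n - (i + 1)) (1 : ℤ) - Finsupp.single (n - i) 1 := by
      rw [← show n - (i + 1) + 1 = n - i by omega]
      rfl
    rw [← hv]
    exact cutV_straighten ∅ _ (by simp) (by simp) β N hN hgap
  · intro i _ hi
    have := hf (show n - (i + 1) ≤ n - i by omega)
    rw [gapHom_apply, hα, hα, show n - (i + 1) + 1 = n - i by omega, Nat.cast_sub this]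

theorem sum_lower_straighten (n : ℕ) (hn0 : 0 < n) (f : ℕ → ℕ) (hf : Antitone f) {α : ℕ →₀ ℤ}
    (hα : ∀ i, α i = f i) (hn : f n = 0) (r : ℕ) :
    Vi α * v r = ∑ ab ∈ antidiagonal r, θ ^ ab.1 •
      ∑ γ ∈ finsuppAntidiag (Ico 0 n) ab.1, rowProd tθ (fun i => f i - f (i + 1)) n 0 tθ γ •
        cutV (raiseOps n n) (α + comb (fun i => -Finsupp.single i (1 : ℤ)) γ
              + Finsupp.single n (ab.2 : ℤ)) := by
  have hα0 : ∀ J, n ≤ J → α J = 0 := by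
    intro J hJ
    have := hf hJ
    rw [hα, show f J = 0 by omega, Nat.cast_zero]
  rw [← cutV_add_single n hα0, ← raiseLowerOps_self, cutV_raiseLowerOps le_rfl hα0]
  refine Finset.sum_congr rfl fun ab _ => ?_
  congr 1
  have h := straighten tθ (fun i => -Finsupp.single i (1 : ℤ)) gapHom
    (fun i => f i - f (i + 1)) n (cutV (raiseOps n n)) ?_ ?_ ?_ ?_ n 0 (by omega) tθ ab.1
    (α + Finsupp.single n (ab.2 : ℤ)) ?_
  · simp_rw [add_right_comm α]
    rw [← h]
    refine Finset.sum_congr rfl fun γ _ => ?_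
    rw [Finset.prod_eq_prod_Ico_succ_bot hn0]
  · intro i hi
    rw [gapHom_apply, Finsupp.neg_apply, Finsupp.neg_apply, Finsupp.single_eq_same,
      Finsupp.single_eq_of_ne (by omega)]
    norm_num
  · intro i hi
    rw [gapHom_apply, Finsupp.neg_apply, Finsupp.neg_apply, Finsupp.single_eq_same,
      Finsupp.single_eq_of_ne (by omega)]
    norm_num
  · intro i l hi hl h1 h2
    rw [gapHom_apply, Finsupp.neg_apply, Finsupp.neg_apply, Finsupp.single_eq_of_ne (by omega),
      Finsupp.single_eq_of_ne (by omega)]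
    norm_num
  · intro i hi β N hN hgap
    have hv : stepVec (Sum.inl (adj i))
        = -Finsupp.single (i + 1) (1 : ℤ) - -Finsupp.single i 1 := by
      simp only [stepVec, adj]
      abel
    rw [← hv]
    refine cutV_straighten (raiseOps n n) _ ?_ (opSwap_mem_raiseOps hi) β N hN hgap
    simp only [raiseOps, adj, Set.mem_ofPred_eq, Sum.elim_inl]
    omega
  · intro i _ hi
    have := hf (show i ≤ i + 1 by omega)
    rw [map_add, gapHom_apply, gapHom_apply, hα, hα, Nat.cast_sub this,
      Finsupp.single_eq_of_ne (by omega), Finsupp.single_eq_of_ne (by omega)]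
    norm_num

/-- Terms with a negative last entry vanish. -/
theorem cutV_raiseOps_eq_zero {n : ℕ} {α : ℕ →₀ ℤ} (hα : ∀ J, n + 1 < J → α J = 0) (h : α n < 0) :
    cutV (raiseOps (n + 1) (n + 1)) α = 0 := by
  refine cutV_eq_zero _ hα h fun e he hle => ?_
  rcases e with ⟨⟨a, b⟩, hab⟩ | ⟨⟨a, b⟩, hab⟩
  · simp only [raiseOps, Set.mem_ofPred_eq, Sum.elim_inl] at he
    simp only [hi, Sum.elim_inl] at hle
    simp only at hab
    simp only [stepVec, Finsupp.sub_apply]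
    rw [Finsupp.single_eq_of_ne (show n ≠ a by omega), Finsupp.single_apply]
    split_ifs <;> norm_num
  · simp only [stepVec, Finsupp.sub_apply, Finsupp.neg_apply, Finsupp.single_apply]
    split_ifs <;> norm_num

/-! ### Row parameters of a horizontal strip -/

section RowParameters

variable {R : Type*} [CommRing R]

open scoped Classical in
-- The parameter vanishes when the strip has a box in the column just right of row i. The recursion
-- restarts at t if row i stays longer than μ_{i+1}, gains a factor t inside a run of equal rows,
-- and drops to 0 if row i is cut down exactly to a shorter next row.
theorem lowerParam_eq (t : R) (μ ν : ℕ → ℕ) (hμ : Antitone μ) (h1 : ∀ i, ν i ≤ μ i)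
    (h2 : ∀ i, μ (i + 1) ≤ ν i) (E : ℕ → R) (h0 : E 0 = t)
    (hE : ∀ i, E (i + 1) = nextParam t (E i) (μ i - μ (i + 1)) (μ i - ν i)) (i : ℕ) :
    E i = if ∃ j, ν j ≤ μ i ∧ μ i < μ j then 0 else t ^ #{j ∈ range (i + 1) | μ j = μ i} := by
  have hν : ∀ {j k}, j < k → μ k ≤ ν j := fun hjk => (hμ hjk).trans (h2 _)
  induction i with
  | zero =>
    rw [if_neg, h0]
    · simp [Finset.filter_singleton]
    · rintro ⟨j, -, hj⟩
      exact absurd (hμ (Nat.zero_le j)) (by omega)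
  | succ i ih =>
    have hi1 := h1 i
    have hi2 := h2 i
    rw [hE, nextParam]
    rcases lt_or_ge (μ (i + 1)) (ν i) with h | h
    · rw [if_pos (by omega), if_neg]
      · have : {j ∈ range (i + 1 + 1) | μ j = μ (i + 1)} = {i + 1} := by
          ext j
          simp only [mem_filter, mem_range, mem_singleton]
          constructor
          · rintro ⟨hj, hj'⟩
            by_contra hne
            have := hμ (show j ≤ i by omega)
            omega
          · rintro rfl
            simp
        rw [this, Finset.card_singleton, pow_one]
      · rintro ⟨j, hj1, hj2⟩
        have hji : j < i + 1 := by
          by_contra hji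
          exact absurd (hμ (not_lt.1 hji)) (by omega)
        rcases (Nat.lt_succ_iff.1 hji).lt_or_eq with hji | rfl
        · have := hν hji
          omega
        · omega
    · rw [if_neg (by omega)]
      by_cases hg : μ i - μ (i + 1) = 0
      · have he : μ (i + 1) = μ i := by omega
        rw [if_pos hg, ih, he]
        by_cases hc : ∃ j, ν j ≤ μ i ∧ μ i < μ j
        · rw [if_pos hc, if_pos hc, mul_zero]
        · rw [if_neg hc, if_neg hc, Finset.range_add_one (n := i + 1), Finset.filter_insert,
            if_pos he, Finset.card_insert_of_notMem (by simp), pow_succ, mul_comm]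
      · rw [if_neg hg, if_pos ⟨i, h, by omega⟩]

open scoped Classical in
-- The mirror image, from the bottom up: the parameter is 0 for an empty row, or when the strip has
-- a box in the last column of row n - s of ν; otherwise it counts the rows of that length met so
-- far.
theorem raiseParam_eq (t : R) (lam ν : ℕ → ℕ) (hlam : Antitone lam) (hν : Antitone ν)
    (h1 : ∀ i, ν i ≤ lam i) (h2 : ∀ i, lam (i + 1) ≤ ν i) (n : ℕ) (hn : ν n = 0) (E : ℕ → R)
    (h0 : E 0 = 0)
    (hE : ∀ s, E (s + 1) = nextParam t (E s) (ν (n - (s + 1)) - ν (n - s))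
      (lam (n - s) - ν (n - s))) (s : ℕ) (hs : s ≤ n) :
    E s = if ν (n - s) = 0 ∨ ∃ j, ν j < ν (n - s) ∧ ν (n - s) ≤ lam j then 0
      else t ^ #{j ∈ Icc (n - s) n | ν j = ν (n - s)} := by
  induction s with
  | zero => simp [h0, hn]
  | succ s ih =>
    have ih := ih (by omega)
    rw [hE, nextParam]
    obtain ⟨i, hi⟩ : ∃ i, i = n - (s + 1) := ⟨_, rfl⟩
    have hi' : n - s = i + 1 := by omega
    rw [hi'] at ih
    rw [← hi, hi']
    have ha := h1 (i + 1)
    have hb := h2 i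
    have hc := hν (Nat.le_succ i)
    simp only [Nat.succ_eq_add_one] at hc
    rcases lt_or_ge (lam (i + 1)) (ν i) with h | h
    · rw [if_pos (by omega), if_neg]
      · have : {j ∈ Icc i n | ν j = ν i} = {i} := by
          ext j
          simp only [mem_filter, mem_Icc, mem_singleton]
          constructor
          · rintro ⟨hj, hj'⟩
            by_contra hne
            have := hν (show i + 1 ≤ j by omega)
            omega
          · rintro rfl
            simp
            omega
        rw [this, Finset.card_singleton, pow_one]
      · rintro (h0 | ⟨j, hj1, hj2⟩)
        · omega
        · have hij : i + 1 ≤ j := by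
            by_contra hji
            exact absurd (hν (show j ≤ i by omega)) (by omega)
          have := hlam hij
          omega
    · rw [if_neg (by omega)]
      by_cases hg : ν i - ν (i + 1) = 0
      · have he : ν (i + 1) = ν i := by omega
        rw [if_pos hg, ih, he]
        by_cases hc : ν i = 0 ∨ ∃ j, ν j < ν i ∧ ν i ≤ lam j
        · rw [if_pos hc, if_pos hc, mul_zero]
        · rw [if_neg hc, if_neg hc, ← Finset.insert_Icc_add_one_left_eq_Icc (show i ≤ n by omega),
            Finset.filter_insert, if_pos rfl, Finset.card_insert_of_notMem (by simp), pow_succ,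
            mul_comm]
      · rw [if_neg hg, if_pos (Or.inr ⟨i + 1, by omega, h⟩)]

end RowParameters

/-! ### Young diagrams by rows -/

theorem YoungDiagram_ext {μ ν : YoungDiagram} (h : ∀ i, μ.rowLen i = ν.rowLen i) : μ = ν := by
  ext ⟨i, j⟩
  rw [YoungDiagram.mem_cells, YoungDiagram.mem_cells, YoungDiagram.mem_iff_lt_rowLen,
    YoungDiagram.mem_iff_lt_rowLen, h]

/-- The Young diagram with given row lengths. -/
def ofRows (f : ℕ → ℕ) (hf : Antitone f) (N : ℕ) : YoungDiagram where
  cells := {c ∈ range N ×ˢ range (f 0) | c.2 < f c.1}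
  isLowerSet := by
    rintro ⟨i, j⟩ ⟨i', j'⟩ hle h
    obtain ⟨h1, h2⟩ := Prod.mk_le_mk.1 hle
    simp only [coe_filter, mem_product, mem_range, Set.mem_ofPred_eq] at h ⊢
    have := hf h1
    omega

theorem rowLen_ofRows (f : ℕ → ℕ) (hf : Antitone f) (N : ℕ) (hN : f N = 0) (i : ℕ) :
    (ofRows f hf N).rowLen i = f i := by
  refine Nat.le_antisymm ?_ ?_ <;> by_contra h <;> rw [not_le] at h
  · rw [← YoungDiagram.mem_iff_lt_rowLen, ← YoungDiagram.mem_cells] at h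
    simp [ofRows] at h
  · have h1 : (i, (ofRows f hf N).rowLen i) ∈ ofRows f hf N := by
      rw [← YoungDiagram.mem_cells]
      simp only [ofRows, mem_filter, mem_product, mem_range]
      refine ⟨⟨?_, lt_of_lt_of_le h (hf (Nat.zero_le i))⟩, h⟩
      by_contra hi
      have := hf (not_lt.1 hi)
      simp only [ofRows] at h
      omega
    rw [YoungDiagram.mem_iff_lt_rowLen] at h1
    exact lt_irrefl _ h1

theorem partSeq_apply (μ : YoungDiagram) (i : ℕ) : partSeq μ i = (μ.rowLen i : ℤ) := rfl

theorem rowLen_antitone (μ : YoungDiagram) : Antitone μ.rowLen := fun i j h => μ.rowLen_anti i j h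

theorem le_iff_rowLen {μ ν : YoungDiagram} : ν ≤ μ ↔ ∀ i, ν.rowLen i ≤ μ.rowLen i := by
  constructor
  · intro h i
    by_contra hlt
    rw [not_le, ← YoungDiagram.mem_iff_lt_rowLen] at hlt
    exact lt_irrefl _ (YoungDiagram.mem_iff_lt_rowLen.1 (h hlt))
  · rintro h ⟨i, j⟩ hij
    exact YoungDiagram.mem_iff_lt_rowLen.2
      ((YoungDiagram.mem_iff_lt_rowLen.1 hij).trans_le (h i))

theorem mem_skew {lam ν : YoungDiagram} {i j : ℕ} :
    (i, j) ∈ lam.cells \ ν.cells ↔ ν.rowLen i ≤ j ∧ j < lam.rowLen i := by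
  rw [mem_sdiff, YoungDiagram.mem_cells, YoungDiagram.mem_cells, YoungDiagram.mem_iff_lt_rowLen,
    YoungDiagram.mem_iff_lt_rowLen, not_lt, and_comm]

theorem card_skew {lam ν : YoungDiagram} {N : ℕ} (hN : lam.rowLen N = 0) :
    #(lam.cells \ ν.cells) = ∑ i ∈ range N, (lam.rowLen i - ν.rowLen i) := by
  rw [Finset.card_eq_sum_card_fiberwise (f := Prod.fst) (t := range N)]
  · refine Finset.sum_congr rfl fun i _ => ?_
    have : {c ∈ lam.cells \ ν.cells | c.1 = i} = {i} ×ˢ Ico (ν.rowLen i) (lam.rowLen i) := by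
      ext ⟨a, b⟩
      rw [mem_filter, mem_skew, mem_product, mem_singleton, mem_Ico]
      constructor
      · rintro ⟨h, rfl⟩
        exact ⟨rfl, h⟩
      · rintro ⟨rfl, h⟩
        exact ⟨h, rfl⟩
    rw [this]
    simp
  · rintro ⟨a, b⟩ h
    have h := mem_skew.1 h
    simp only [coe_range, Set.mem_Iio]
    by_contra ha
    have := rowLen_antitone lam (not_lt.1 ha)
    omega

/-- The conditions on the row lengths for a horizontal strip. -/
def Interlace (ν lam : YoungDiagram) : Prop :=
  (∀ i, ν.rowLen i ≤ lam.rowLen i) ∧ ∀ i, lam.rowLen (i + 1) ≤ ν.rowLen i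

theorem Interlace.skewCol_le_one {ν lam : YoungDiagram} (h : Interlace ν lam) (c : ℕ) :
    skewCol lam ν c ≤ 1 := by
  rw [skewCol, Finset.card_le_one]
  rintro ⟨i, j⟩ h1 ⟨i', j'⟩ h2
  rw [mem_filter, mem_skew] at h1 h2
  obtain rfl : j = j' := by omega
  have key : ∀ {a b : ℕ}, a < b → ν.rowLen a ≤ j → j < lam.rowLen b → False := by
    intro a b hab ha hb
    have h3 := rowLen_antitone lam (show a + 1 ≤ b from hab)
    have h4 := h.2 a
    omega
  rcases lt_trichotomy i i' with hi | rfl | hi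
  · exact (key hi h1.1.1 h2.1.2).elim
  · rfl
  · exact (key hi h2.1.1 h1.1.2).elim

theorem isHorizontalStrip_iff {b : ℕ} {ν lam : YoungDiagram} {N : ℕ} (hN : lam.rowLen N = 0) :
    IsHorizontalStrip b ν lam
      ↔ Interlace ν lam ∧ ∑ i ∈ range N, (lam.rowLen i - ν.rowLen i) = b := by
  rw [IsHorizontalStrip, card_skew hN, le_iff_rowLen, ← and_assoc]
  refine and_congr_left fun _ => ⟨fun h => ⟨h.1, fun i => ?_⟩, fun h => ⟨h.1, h.skewCol_le_one⟩⟩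
  -- If lam_{i+1} > ν_i, then rows i and i + 1 both have a strip box in column ν_i + 1.
  by_contra hlt
  rw [not_le] at hlt
  have h1 : (i, ν.rowLen i) ∈ {c ∈ lam.cells \ ν.cells | c.2 + 1 = ν.rowLen i + 1} := by
    rw [mem_filter, mem_skew]
    exact ⟨⟨le_rfl, hlt.trans_le (rowLen_antitone lam (Nat.le_succ i))⟩, rfl⟩
  have h2 : (i + 1, ν.rowLen i) ∈ {c ∈ lam.cells \ ν.cells | c.2 + 1 = ν.rowLen i + 1} := by
    rw [mem_filter, mem_skew]
    exact ⟨⟨rowLen_antitone ν (Nat.le_succ i), hlt⟩, rfl⟩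
  have h3 := Finset.card_le_one.1 (h.2 (ν.rowLen i + 1)) _ h1 _ h2
  simp at h3

theorem skewCol_eq_zero_iff {lam ν : YoungDiagram} (c : ℕ) :
    skewCol lam ν (c + 1) = 0 ↔ ¬ ∃ i, ν.rowLen i ≤ c ∧ c < lam.rowLen i := by
  rw [skewCol, Finset.card_eq_zero, Finset.filter_eq_empty_iff]
  constructor
  · rintro h ⟨i, hi⟩
    exact h (mem_skew.2 hi) rfl
  · rintro h ⟨i, j⟩ hij hj
    obtain rfl : j = c := by simpa using hj
    exact h ⟨i, mem_skew.1 hij⟩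

theorem Interlace.skewCol_eq_one_iff {ν lam : YoungDiagram} (h : Interlace ν lam) (c : ℕ) :
    skewCol lam ν (c + 1) = 1 ↔ ∃ i, ν.rowLen i ≤ c ∧ c < lam.rowLen i := by
  have h1 := h.skewCol_le_one (c + 1)
  have h2 := skewCol_eq_zero_iff (lam := lam) (ν := ν) c
  rw [← not_iff_not, ← h2]
  omega

theorem mult_eq_card (μ : YoungDiagram) {c N : ℕ} (hc : 0 < c) (hN : μ.rowLen N = 0) :
    mult c μ = #{i ∈ range N | μ.rowLen i = c} := by
  have h1 : mult c μ = #{i ∈ range (μ.colLen 0) | μ.rowLen i = c} := by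
    rw [mult, YoungDiagram.rowLens, List.count, List.countP_map, List.countP_eq_length_filter]
    change _ = (List.filter (fun i => decide (μ.rowLen i = c)) (List.range _)).length
    congr 2
  rw [h1]
  congr 1
  ext i
  simp only [mem_filter, mem_range]
  refine and_congr_left fun hi => ?_
  rw [← YoungDiagram.mem_iff_lt_colLen, YoungDiagram.mem_iff_lt_rowLen]
  constructor
  · intro _
    by_contra hi'
    have := rowLen_antitone μ (not_lt.1 hi')
    omega
  · omega

/-! ### The coefficients of horizontal strips -/

section Coefficients

variable {R : Type*} [CommRing R]

/-- A row that loses boxes contributes a nontrivial factor only if no strip box lies in the column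
after its end. Sending such a row to its length μ_i matches these rows with the columns in φ, where
the strip stops. -/
theorem phi_eq_prod (t : R) {μ ν : YoungDiagram} (h : Interlace ν μ) {n : ℕ}
    (hn : μ.rowLen n = 0) (E : ℕ → R) (h0 : E 0 = t)
    (hE : ∀ i, E (i + 1) = nextParam t (E i) (μ.rowLen i - μ.rowLen (i + 1))
      (μ.rowLen i - ν.rowLen i)) :
    ∏ i ∈ range n, stripCoeff (E i) (μ.rowLen i - ν.rowLen i) = phi μ ν t := by
  classical
  have hμ := rowLen_antitone μ
  have hterm : ∀ i ∈ range n, stripCoeff (E i) (μ.rowLen i - ν.rowLen i)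
      = if ν.rowLen i < μ.rowLen i ∧ skewCol μ ν (μ.rowLen i + 1) = 0
        then 1 - t ^ mult (μ.rowLen i) μ else 1 := by
    intro i hi
    rw [mem_range] at hi
    rw [lowerParam_eq t _ _ hμ h.1 h.2 E h0 hE i, stripCoeff]
    have h1 := h.1 i
    have hsk := skewCol_eq_zero_iff (lam := μ) (ν := ν) (μ.rowLen i)
    by_cases hlt : ν.rowLen i < μ.rowLen i
    · rw [if_neg (by omega)]
      by_cases hc : ∃ j, ν.rowLen j ≤ μ.rowLen i ∧ μ.rowLen i < μ.rowLen j
      · rw [if_pos hc, if_neg fun h3 => hsk.1 h3.2 hc, sub_zero]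
      · rw [if_neg hc, if_pos ⟨hlt, hsk.2 hc⟩, mult_eq_card μ (by omega) hn]
        -- Row i loses a box, so all later rows are strictly shorter: the rows of this length up to
        -- i are all of them.
        congr 3
        ext j
        simp only [mem_filter, mem_range]
        refine and_congr_left fun hj => ?_
        constructor
        · omega
        · intro _
          by_contra hji
          have := hμ (show i + 1 ≤ j by omega)
          have := h.2 i
          omega
    · rw [if_pos (by omega), if_neg (by tauto)]
  rw [Finset.prod_congr rfl hterm, ← Finset.prod_filter, phi]
  refine Finset.prod_bij (fun i _ => μ.rowLen i) ?_ ?_ ?_ ?_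
  · intro i hi
    rw [mem_filter, mem_range] at hi
    rw [mem_filter, mem_Icc]
    refine ⟨⟨by omega, hμ (Nat.zero_le i)⟩, ?_, hi.2.2⟩
    obtain ⟨c, hc⟩ := Nat.exists_eq_add_of_lt (show 0 < μ.rowLen i by omega)
    rw [zero_add] at hc
    rw [hc, h.skewCol_eq_one_iff]
    exact ⟨i, by omega, by omega⟩
  · intro i hi j hj hij
    rw [mem_filter] at hi hj
    have key : ∀ {a b : ℕ}, a < b → ν.rowLen a < μ.rowLen a → μ.rowLen a = μ.rowLen b → False := by
      intro a b hab ha hb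
      have h3 := hμ (show a + 1 ≤ b from hab)
      have h4 := h.2 a
      omega
    rcases lt_trichotomy i j with hlt | rfl | hlt
    · exact (key hlt hi.2.1 hij).elim
    · rfl
    · exact (key hlt hj.2.1 hij.symm).elim
  · intro c hc
    rw [mem_filter, mem_Icc] at hc
    obtain ⟨⟨hc1, -⟩, hc2, hc3⟩ := hc
    obtain ⟨d, rfl⟩ := Nat.exists_eq_add_of_lt (show 0 < c by omega)
    rw [zero_add] at *
    rw [h.skewCol_eq_one_iff] at hc2
    obtain ⟨i, hi1, hi2⟩ := hc2
    have hi3 : μ.rowLen i = d + 1 := by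
      rw [skewCol_eq_zero_iff] at hc3
      by_contra hne
      exact hc3 ⟨i, by omega, by omega⟩
    refine ⟨i, ?_, hi3⟩
    rw [mem_filter, mem_range, hi3]
    refine ⟨?_, by omega, hc3⟩
    by_contra hin
    have := hμ (not_lt.1 hin)
    omega
  · intro i _
    rfl

/-- A row that gains boxes gets a nontrivial factor only if ν_i > 0 and column ν_i is free of strip
boxes. Sending it to ν_i matches these rows with the columns in ψ, just before the strip starts. -/
theorem psi_eq_prod (t : R) {lam ν : YoungDiagram} (h : Interlace ν lam) {n : ℕ}
    (hn : ν.rowLen n = 0) (E : ℕ → R) (h0 : E 0 = 0)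
    (hE : ∀ s, E (s + 1) = nextParam t (E s) (ν.rowLen (n - (s + 1)) - ν.rowLen (n - s))
      (lam.rowLen (n - s) - ν.rowLen (n - s))) :
    ∏ s ∈ range (n + 1), stripCoeff (E s) (lam.rowLen (n - s) - ν.rowLen (n - s))
      = psi lam ν t := by
  classical
  have hlam := rowLen_antitone lam
  have hν := rowLen_antitone ν
  have hcol : ∀ c, 0 < c → (skewCol lam ν c = 0 ↔ ¬ ∃ j, ν.rowLen j < c ∧ c ≤ lam.rowLen j) := by
    intro c hc
    obtain ⟨d, rfl⟩ := Nat.exists_eq_add_of_lt hc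
    rw [skewCol_eq_zero_iff]
    simp only [zero_add, Nat.lt_succ_iff, Nat.succ_le_iff]
  have hterm : ∀ s ∈ range (n + 1), stripCoeff (E s) (lam.rowLen (n - s) - ν.rowLen (n - s))
      = if ν.rowLen (n - s) < lam.rowLen (n - s) ∧ 0 < ν.rowLen (n - s)
          ∧ skewCol lam ν (ν.rowLen (n - s)) = 0
        then 1 - t ^ mult (ν.rowLen (n - s)) ν else 1 := by
    intro s hs
    rw [mem_range] at hs
    rw [raiseParam_eq t _ _ hlam hν h.1 h.2 n hn E h0 hE s (by omega), stripCoeff]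
    obtain ⟨i, hi⟩ : ∃ i, i = n - s := ⟨_, rfl⟩
    rw [← hi]
    have h1 := h.1 i
    by_cases hlt : ν.rowLen i < lam.rowLen i
    · rw [if_neg (by omega)]
      by_cases hz : ν.rowLen i = 0
      · simp [hz]
      · have hsk := hcol (ν.rowLen i) (by omega)
        by_cases hc : ∃ j, ν.rowLen j < ν.rowLen i ∧ ν.rowLen i ≤ lam.rowLen j
        · rw [if_pos (Or.inr hc), if_neg fun h3 => hsk.1 h3.2.2 hc, sub_zero]
        · rw [if_neg (not_or.2 ⟨hz, hc⟩), if_pos ⟨hlt, by omega, hsk.2 hc⟩, mult_eq_card ν (by omega) hn]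
          -- Row i gains a box, so all earlier rows of ν are strictly longer: the rows of this
          -- length from i on are all of them.
          congr 3
          ext j
          simp only [mem_filter, mem_range, mem_Icc]
          refine and_congr_left fun hj => ?_
          constructor
          · rintro ⟨-, h3⟩
            rcases h3.lt_or_eq with h3 | rfl
            · exact h3
            · omega
          · intro h3
            refine ⟨?_, h3.le⟩
            by_contra hji
            have := hlam (show j + 1 ≤ i by omega)
            have := h.2 j
            omega
    · rw [if_pos (by omega), if_neg (by tauto)]
  have hrefl := Finset.prod_range_reflect (fun i =>
    if ν.rowLen i < lam.rowLen i ∧ 0 < ν.rowLen i ∧ skewCol lam ν (ν.rowLen i) = 0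
        then 1 - t ^ mult (ν.rowLen i) ν else 1) (n + 1)
  simp only [add_tsub_cancel_right] at hrefl
  rw [Finset.prod_congr rfl hterm, hrefl, ← Finset.prod_filter, psi]
  refine Finset.prod_bij (fun i _ => ν.rowLen i) ?_ ?_ ?_ ?_
  · intro i hi
    rw [mem_filter, mem_range] at hi
    rw [mem_filter, mem_Icc, h.skewCol_eq_one_iff]
    refine ⟨⟨hi.2.2.1, (hi.2.1.trans_le (hlam (Nat.zero_le i))).le⟩, hi.2.2.2, i, le_rfl, hi.2.1⟩
  · intro i hi j hj hij
    rw [mem_filter] at hi hj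
    have key : ∀ {a b : ℕ}, a < b → ν.rowLen b < lam.rowLen b → ν.rowLen a = ν.rowLen b →
        False := by
      intro a b hab hb hab'
      have h3 := hlam (show a + 1 ≤ b from hab)
      have h4 := h.2 a
      omega
    rcases lt_trichotomy i j with hlt | rfl | hlt
    · exact (key hlt hj.2.1 hij).elim
    · rfl
    · exact (key hlt hi.2.1 hij.symm).elim
  · intro c hc
    rw [mem_filter, mem_Icc, h.skewCol_eq_one_iff, hcol c (by omega)] at hc
    obtain ⟨⟨hc1, -⟩, hc2, i, hi1, hi2⟩ := hc
    have hi3 : ν.rowLen i = c := by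
      by_contra hne
      exact hc2 ⟨i, by omega, by omega⟩
    refine ⟨i, ?_, hi3⟩
    rw [mem_filter, mem_range, hi3, hcol c (by omega)]
    refine ⟨?_, hi2, by omega, hc2⟩
    by_contra hin
    have := hlam (not_lt.1 hin)
    have := h.2 n
    omega
  · intro i _
    rfl

end Coefficients

/-! ### The Pieri rule -/

/-- The sequence of row parameters of a choice `γ` of numbers of boxes. -/
def rowParam {R : Type*} [CommRing R] (t e : R) (g γ : ℕ → ℕ) : ℕ → R
  | 0 => e
  | i + 1 => nextParam t (rowParam t e g γ i) (g i) (γ i)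

theorem C_phi (μ ν : YoungDiagram) : Polynomial.C (phi μ ν tt) = phi μ ν tθ := by
  simp [phi, tθ, map_prod]

theorem C_psi (lam ν : YoungDiagram) : Polynomial.C (psi lam ν tt) = psi lam ν tθ := by
  simp [psi, tθ, map_prod]

/-! ### Box numbers per row versus horizontal strips -/

theorem comb_lower_apply (γ : ℕ →₀ ℕ) (k : ℕ) :
    comb (fun i => -Finsupp.single i (1 : ℤ)) γ k = -(γ k : ℤ) := by
  induction γ using Finsupp.induction_linear with
  | zero => simp
  | add f g hf hg =>
    rw [map_add, Finsupp.add_apply, hf, hg, Finsupp.add_apply]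
    push_cast
    ring
  | single i m =>
    rw [comb_single]
    by_cases h : k = i <;> simp [h]

theorem comb_raise_apply {n b : ℕ} {γ : ℕ →₀ ℕ} (hγ : γ ∈ finsuppAntidiag (Ico 0 (n + 1)) b)
    (k : ℕ) : comb (fun i => Finsupp.single (n - i) (1 : ℤ)) γ k
      = if k ≤ n then (γ (n - k) : ℤ) else 0 := by
  rw [comb_eq_sum, Finset.sum_subset (mem_finsuppAntidiag.1 hγ).2, Finsupp.finsetSum_apply]
  · split_ifs with hk
    · rw [Finset.sum_eq_single (n - k)]
      · simp [show n - (n - k) = k by omega]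
      · intro i hi hne
        rw [mem_Ico] at hi
        rw [Finsupp.smul_apply, Finsupp.single_eq_of_ne (by omega), smul_zero]
      · intro h
        exact absurd (by rw [mem_Ico]; omega) h
    · refine Finset.sum_eq_zero fun i _ => ?_
      rw [Finsupp.smul_apply, Finsupp.single_eq_of_ne (by omega), smul_zero]
  · intro i _ hi
    rw [Finsupp.notMem_support_iff.1 hi, zero_smul]

theorem mem_downStrips {a n : ℕ} {μ ν : YoungDiagram} (hn : μ.rowLen n = 0) :
    ν ∈ downStrips a μ
      ↔ Interlace ν μ ∧ ∑ i ∈ range n, (μ.rowLen i - ν.rowLen i) = a := by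
  rw [downStrips, Set.Finite.mem_toFinset, Set.mem_ofPred_eq, isHorizontalStrip_iff hn]

theorem mem_upStrips {b n : ℕ} {ν lam : YoungDiagram} (hn : ν.rowLen n = 0) :
    lam ∈ upStrips b ν
      ↔ Interlace ν lam ∧ ∑ i ∈ range (n + 1), (lam.rowLen i - ν.rowLen i) = b := by
  rw [upStrips, Set.Finite.mem_toFinset, Set.mem_ofPred_eq]
  have h0 : lam.rowLen (lam.colLen 0) = 0 := by
    by_contra h
    have := YoungDiagram.mem_iff_lt_rowLen.2 (Nat.pos_of_ne_zero h)
    rw [YoungDiagram.mem_iff_lt_colLen] at this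
    exact lt_irrefl _ this
  constructor
  · intro h
    have h1 := ((isHorizontalStrip_iff h0).1 h).1
    have h2 : lam.rowLen (n + 1) = 0 := by
      have := h1.2 n
      omega
    exact (isHorizontalStrip_iff h2).1 h
  · intro h
    have h2 : lam.rowLen (n + 1) = 0 := by
      have := h.1.2 n
      omega
    exact (isHorizontalStrip_iff h2).2 h

/-- A strip is determined by its number of boxes in each row. Choices γ that do not come from a
strip contribute zero. -/
theorem sum_downStrips (n : ℕ) (μ : YoungDiagram) (hn : μ.rowLen (n + 1) = 0) (a b : ℕ) :
    ∑ ν ∈ downStrips a μ, phi μ ν tθ • cutV (raiseOps (n + 1) (n + 1))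
        (partSeq ν + Finsupp.single (n + 1) (b : ℤ))
      = ∑ γ ∈ finsuppAntidiag (Ico 0 (n + 1)) a,
        rowProd tθ (fun i => μ.rowLen i - μ.rowLen (i + 1)) (n + 1) 0 tθ γ •
          cutV (raiseOps (n + 1) (n + 1)) (partSeq μ + comb (fun i => -Finsupp.single i (1 : ℤ)) γ
              + Finsupp.single (n + 1) (b : ℤ)) := by
  classical
  have hμ := rowLen_antitone μ
  let boxes : YoungDiagram → (ℕ →₀ ℕ) := fun ν =>
    Finsupp.onFinset (range (n + 1)) (fun i => μ.rowLen i - ν.rowLen i) (by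
      intro i hi
      rw [mem_range]
      by_contra h
      have := hμ (not_lt.1 h)
      omega)
  have hboxes : ∀ ν i, boxes ν i = μ.rowLen i - ν.rowLen i := fun _ _ => rfl
  refine Finset.sum_of_injOn boxes ?_ ?_ ?_ ?_
  · intro ν hν ν' hν' h
    have h1 := ((mem_downStrips hn).1 hν).1.1
    have h2 := ((mem_downStrips hn).1 hν').1.1
    refine YoungDiagram_ext fun i => ?_
    have h3 := DFunLike.congr_fun h i
    rw [hboxes, hboxes] at h3
    have := h1 i
    have := h2 i
    omega
  · intro ν hν
    have h1 := ((mem_downStrips hn).1 hν).2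
    rw [mem_coe, mem_finsuppAntidiag, ← Finset.range_eq_Ico]
    exact ⟨h1, Finsupp.support_onFinset_subset⟩
  · intro γ hγ hnot
    by_cases hlast : γ n ≤ μ.rowLen n
    · rw [show rowProd tθ (fun i => μ.rowLen i - μ.rowLen (i + 1)) (n + 1) 0 tθ γ = _ from
        rowProd_eq tθ _ (n + 1) 0 (rowParam tθ tθ _ γ) γ fun _ => rfl]
      rw [if_neg, zero_smul]
      intro hcond
      have hγn : ∀ i, n < i → γ i = 0 := fun i hi =>
        eq_zero_of_mem_finsuppAntidiag hγ (by rw [mem_Ico]; omega)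
      have hle : ∀ i, γ i ≤ μ.rowLen i - μ.rowLen (i + 1) := by
        intro i
        rcases lt_trichotomy i n with hi | rfl | hi
        · exact hcond i (Nat.zero_le i) (by omega)
        · omega
        · rw [hγn i hi]
          exact Nat.zero_le _
      have hf : Antitone fun i => μ.rowLen i - γ i := antitone_nat_of_succ_le fun i => by
        have := hle i
        have := hμ (Nat.le_succ i)
        simp only [Nat.succ_eq_add_one] at this
        omega
      have hrow := rowLen_ofRows _ hf (n + 1) (by simp [hn])
      have hb : boxes (ofRows _ hf (n + 1)) = γ := by
        ext i
        rw [hboxes, hrow]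
        have := hle i
        omega
      refine hnot ⟨ofRows _ hf (n + 1), ?_, hb⟩
      rw [mem_coe, mem_downStrips hn]
      refine ⟨⟨fun i => ?_, fun i => ?_⟩, ?_⟩
      · rw [hrow]
        omega
      · rw [hrow]
        have := hle i
        have := hμ (Nat.le_succ i)
        simp only [Nat.succ_eq_add_one] at this
        omega
      · have h1 := (mem_finsuppAntidiag.1 hγ).1
        rw [← hb, ← Finset.range_eq_Ico] at h1
        exact h1
    · rw [cutV_raiseOps_eq_zero, smul_zero]
      · intro J hJ
        have hJ' := hμ hJ.le
        rw [Finsupp.add_apply, Finsupp.add_apply, comb_lower_apply, partSeq_apply,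
          Finsupp.single_eq_of_ne hJ.ne', eq_zero_of_mem_finsuppAntidiag hγ (by rw [mem_Ico]; omega),
          show μ.rowLen J = 0 by omega]
        rfl
      · rw [Finsupp.add_apply, Finsupp.add_apply, comb_lower_apply, partSeq_apply,
          Finsupp.single_eq_of_ne (by omega)]
        omega
  · intro ν hν
    have hν := ((mem_downStrips hn).1 hν).1
    rw [show rowProd tθ (fun i => μ.rowLen i - μ.rowLen (i + 1)) (n + 1) 0 tθ (boxes ν) = _ from
        rowProd_eq tθ _ (n + 1) 0 (rowParam tθ tθ _ (boxes ν)) (boxes ν) fun _ => rfl]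
    rw [if_pos, ← phi_eq_prod tθ hν hn (rowParam tθ tθ _ (boxes ν)) rfl fun _ => rfl, zero_add,
      ← Finset.range_eq_Ico]
    · congr 3
      ext i
      rw [Finsupp.add_apply, comb_lower_apply, partSeq_apply, partSeq_apply, hboxes,
        Nat.cast_sub (hν.1 i)]
      ring
    · intro i _ _
      rw [hboxes]
      have := hν.2 i
      omega

/-- The same dictionary read from the bottom row up. The top row, last in the sweep, may grow
without bound, so no vanishing argument is needed. -/
theorem sum_upStrips (n : ℕ) (ν : YoungDiagram) (hn : ν.rowLen n = 0) (b : ℕ) :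
    ∑ lam ∈ upStrips b ν, psi lam ν tθ • Vi (partSeq lam)
      = ∑ γ ∈ finsuppAntidiag (Ico 0 (n + 1)) b,
          rowProd tθ (fun i => ν.rowLen (n - (i + 1)) - ν.rowLen (n - i)) (n + 1) 0 0 γ •
            Vi (partSeq ν + comb (fun i => Finsupp.single (n - i) (1 : ℤ)) γ) := by
  classical
  have hν := rowLen_antitone ν
  let boxes : YoungDiagram → (ℕ →₀ ℕ) := fun lam =>
    Finsupp.onFinset (range (n + 1))
      (fun s => if s ≤ n then lam.rowLen (n - s) - ν.rowLen (n - s) else 0) (by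
      intro i hi
      rw [mem_range]
      by_contra h
      exact hi (if_neg (by omega)))
  have hboxes : ∀ lam s, s ≤ n → boxes lam s = lam.rowLen (n - s) - ν.rowLen (n - s) :=
    fun _ _ h => if_pos h
  have hboxes' : ∀ lam i, i ≤ n → boxes lam (n - i) = lam.rowLen i - ν.rowLen i := by
    intro lam i hi
    rw [hboxes _ _ (by omega), show n - (n - i) = i by omega]
  have hzero : ∀ {lam : YoungDiagram}, Interlace ν lam → ∀ i, n < i → lam.rowLen i = 0 := by
    intro lam h i hi
    have h1 := rowLen_antitone lam (show n + 1 ≤ i from hi)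
    have h2 := h.2 n
    omega
  have hsum : ∀ lam : YoungDiagram,
      ∑ s ∈ range (n + 1), boxes lam s = ∑ i ∈ range (n + 1), (lam.rowLen i - ν.rowLen i) := by
    intro lam
    rw [← Finset.sum_range_reflect (fun i => lam.rowLen i - ν.rowLen i)]
    refine Finset.sum_congr rfl fun s hs => ?_
    rw [mem_range] at hs
    rw [hboxes _ _ (by omega), add_tsub_cancel_right]
  refine Finset.sum_of_injOn boxes ?_ ?_ ?_ ?_
  · intro lam hlam lam' hlam' h
    have h1 := ((mem_upStrips hn).1 hlam).1
    have h2 := ((mem_upStrips hn).1 hlam').1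
    refine YoungDiagram_ext fun i => ?_
    rcases le_or_gt i n with hi | hi
    · have h3 := DFunLike.congr_fun h (n - i)
      rw [hboxes' _ _ hi, hboxes' _ _ hi] at h3
      have := h1.1 i
      have := h2.1 i
      omega
    · rw [hzero h1 i hi, hzero h2 i hi]
  · intro lam hlam
    have h1 := ((mem_upStrips hn).1 hlam).2
    rw [mem_coe, mem_finsuppAntidiag, ← Finset.range_eq_Ico]
    exact ⟨(hsum lam).trans h1, Finsupp.support_onFinset_subset⟩
  · intro γ hγ hnot
    rw [show rowProd tθ (fun i => ν.rowLen (n - (i + 1)) - ν.rowLen (n - i)) (n + 1) 0 0 γ = _ from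
      rowProd_eq tθ _ (n + 1) 0 (rowParam tθ 0 _ γ) γ fun _ => rfl]
    rw [if_neg, zero_smul]
    intro hcond
    have hle : ∀ i, i + 1 ≤ n → γ (n - (i + 1)) ≤ ν.rowLen i - ν.rowLen (i + 1) := by
      intro i hi
      have h1 := hcond (n - (i + 1)) (Nat.zero_le _) (by omega)
      rwa [show n - (n - (i + 1) + 1) = i by omega,
        show n - (n - (i + 1)) = i + 1 by omega] at h1
    have hf : Antitone fun i => if i ≤ n then ν.rowLen i + γ (n - i) else 0 :=
      antitone_nat_of_succ_le fun i => by
        by_cases hi : i + 1 ≤ n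
        · have h1 := hle i hi
          have h2 := hν (Nat.le_succ i)
          simp only [Nat.succ_eq_add_one] at h2
          rw [if_pos hi, if_pos (by omega)]
          omega
        · rw [if_neg hi]
          exact Nat.zero_le _
    have hrow := rowLen_ofRows _ hf (n + 1) (by simp)
    have hb : boxes (ofRows _ hf (n + 1)) = γ := by
      ext s
      by_cases hs : s ≤ n
      · rw [hboxes _ _ hs, hrow, if_pos (by omega), show n - (n - s) = s by omega]
        omega
      · rw [eq_zero_of_mem_finsuppAntidiag hγ (by rw [mem_Ico]; omega)]
        exact if_neg hs
    refine hnot ⟨ofRows _ hf (n + 1), ?_, hb⟩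
    rw [mem_coe, mem_upStrips hn]
    refine ⟨⟨fun i => ?_, fun i => ?_⟩, ?_⟩
    · rw [hrow]
      split_ifs with hi
      · omega
      · have := hν (not_le.1 hi).le
        omega
    · rw [hrow]
      split_ifs with hi
      · have h1 := hle i hi
        have h2 := hν (Nat.le_succ i)
        simp only [Nat.succ_eq_add_one] at h2
        omega
      · exact Nat.zero_le _
    · have h1 := (mem_finsuppAntidiag.1 hγ).1
      rw [← hsum, hb, Finset.range_eq_Ico, h1]
  · intro lam hlam
    have hmem : boxes lam ∈ finsuppAntidiag (Ico 0 (n + 1)) b := by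
      rw [mem_finsuppAntidiag, ← Finset.range_eq_Ico]
      exact ⟨(hsum lam).trans ((mem_upStrips hn).1 hlam).2, Finsupp.support_onFinset_subset⟩
    have hlam := ((mem_upStrips hn).1 hlam).1
    rw [show rowProd tθ (fun i => ν.rowLen (n - (i + 1)) - ν.rowLen (n - i)) (n + 1) 0 0
        (boxes lam) = _ from
        rowProd_eq tθ _ (n + 1) 0 (rowParam tθ 0 _ (boxes lam)) (boxes lam) fun _ => rfl]
    have hE : ∀ s, rowParam tθ 0 (fun i => ν.rowLen (n - (i + 1)) - ν.rowLen (n - i))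
          (fun s => lam.rowLen (n - s) - ν.rowLen (n - s)) (s + 1)
        = nextParam tθ (rowParam tθ 0 (fun i => ν.rowLen (n - (i + 1)) - ν.rowLen (n - i))
          (fun s => lam.rowLen (n - s) - ν.rowLen (n - s)) s)
          (ν.rowLen (n - (s + 1)) - ν.rowLen (n - s)) (lam.rowLen (n - s) - ν.rowLen (n - s)) :=
      fun _ => rfl
    have hparam : ∀ s, s ≤ n → rowParam tθ 0 (fun i => ν.rowLen (n - (i + 1)) - ν.rowLen (n - i))
          (boxes lam) s = rowParam tθ 0 (fun i => ν.rowLen (n - (i + 1)) - ν.rowLen (n - i))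
          (fun s => lam.rowLen (n - s) - ν.rowLen (n - s)) s := by
      intro s hs
      induction s with
      | zero => rfl
      | succ s ih => rw [rowParam, rowParam, ih (by omega), hboxes _ _ (by omega)]
    rw [if_pos, ← psi_eq_prod tθ hlam hn _ rfl hE, zero_add, ← Finset.range_eq_Ico]
    · congr 1
      · refine Finset.prod_congr rfl fun s hs => ?_
        rw [mem_range] at hs
        rw [hparam s (by omega), hboxes _ _ (by omega)]
      · congr 1
        ext i
        rw [Finsupp.add_apply, comb_raise_apply hmem, partSeq_apply, partSeq_apply]
        split_ifs with hi
        · rw [hboxes' _ _ hi, Nat.cast_sub (hlam.1 i)]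
          ring
        · have h1 := hzero hlam i (by omega)
          have h2 := hlam.1 i
          rw [h1, show ν.rowLen i = 0 by omega]
          rfl
    · intro s _ hs
      rw [hboxes _ _ (by omega)]
      have := hlam.2 (n - (s + 1))
      rw [show n - (s + 1) + 1 = n - s by omega] at this
      omega

end IHL

end

theorem theoremA (r : ℕ) (hr : 1 ≤ r) (μ : YoungDiagram) :
    IHL.Vi (IHL.partSeq μ) * IHL.v (r : ℤ) =
      ∑ ab ∈ Finset.HasAntidiagonal.antidiagonal r,
        ∑ ν ∈ IHL.downStrips ab.1 μ, ∑ lam ∈ IHL.upStrips ab.2 ν,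
          (IHL.θ ^ ab.1 * Polynomial.C (IHL.phi μ ν IHL.tt) *
              Polynomial.C (IHL.psi lam ν IHL.tt)) •
            IHL.Vi (IHL.partSeq lam) := by
  set n := μ.colLen 0 with hn
  have hμ := IHL.rowLen_antitone μ
  have h0 : μ.rowLen (n + 1) = 0 := by
    by_contra h
    have := YoungDiagram.mem_iff_lt_rowLen.2 (Nat.pos_of_ne_zero h)
    rw [YoungDiagram.mem_iff_lt_colLen] at this
    omega
  -- Allowing one empty row beyond the parts of μ guarantees at least one row to sweep, even for the
  -- empty partition.
  rw [IHL.sum_lower_straighten (n + 1) (Nat.succ_pos n) μ.rowLen hμ (fun _ => rfl) h0]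
  refine Finset.sum_congr rfl fun ab _ => ?_
  rw [← IHL.sum_downStrips n μ h0, Finset.smul_sum]
  refine Finset.sum_congr rfl fun ν hν => ?_
  have hν0 : ν.rowLen (n + 1) = 0 := by
    have := ((IHL.mem_downStrips h0).1 hν).1.1 (n + 1)
    omega
  rw [IHL.sum_raise_straighten (n + 1) ν.rowLen (IHL.rowLen_antitone ν) (fun _ => rfl) hν0,
    ← IHL.sum_upStrips (n + 1) ν hν0, smul_smul, Finset.smul_sum]
  refine Finset.sum_congr rfl fun lam _ => ?_
  rw [smul_smul, IHL.C_phi, IHL.C_psi]
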